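/- Let $k,m,n\ge 0$ be integers, and let $\mathrm{SSYT}_k(m\times n)$ be the (finite) set of semistandard Young tableaux (rows weakly increasing, columns strictly increasing) of rectangular shape with $m$ rows and $n$ columns and with entries in $\{1,\dots,k\}$. The promotion $\mathcal P(T)$ of $T\in\mathrm{SSYT}_k(m\times n)$ is obtained as follows: delete all boxes of $T$ that contain a $1$, rectify the resulting skew tableau by jeu de taquin slides (at each step the empty box is filled from whichever of the boxes immediately below it and immediately to its right contains the smaller value, from the box below if the values are equal), decrease all entries by $1$, and place a $k$ in every box left empty. (If $T$ contains no $1$, all entries are just decreased by $1$.) Then $\mathcal P$ is a well-defined permutation of $\mathrm{SSYT}_k(m\times n)$; let $\langle\mathcal P\rangle$ be the cyclic group that it generates. Let $S$ be a set of boxes of the $m\times n$ rectangle that is fixed under $180^\circ$ rotation, and for $T\in\mathrm{SSYT}_k(m\times n)$ let $\sigma_S(T)$ be the sum of the entries of $T$ in the boxes of $S$. Then $(\mathrm{SSYT}_k(m\times n),\langle\mathcal P\rangle,\sigma_S)$ is homomesic, that is, the average of $\sigma_S$ is the same on all orbits of $\langle\mathcal P\rangle$. More precisely, for every orbit $\mathcal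 O$, $$\frac1{|\mathcal O|}\sum_{T\in\mathcal O}\sigma_S(T)=\frac{(k+1)\,|S|}{2}.$$ -/

import Mathlib

/-- The Young diagram with `m` rows and `n` columns. -/
def rectangle (m n : ℕ) : YoungDiagram where
  cells := Finset.range m ×ˢ Finset.range n
  isLowerSet := by
    rintro ⟨a, b⟩ ⟨c, d⟩ ⟨h₁, h₂⟩ h
    simp only [Finset.coe_product, Finset.coe_range, Set.mem_prod, Set.mem_Iio] at h ⊢
    exact ⟨lt_of_le_of_lt h₁ h.1, lt_of_le_of_lt h₂ h.2⟩

/-- `SSYT k μ` is the set of semistandard Young tableaux of shape `μ` (rows weakly increasing,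
columns strictly increasing) with entries in `{1, …, k}`. Row and column indices start at `0`. -/
def SSYT (k : ℕ) (μ : YoungDiagram) : Type :=
  {T : SemistandardYoungTableau μ // ∀ i j, (i, j) ∈ μ → 1 ≤ T i j ∧ T i j ≤ k}

/-- A filling of the quadrant that encodes a skew tableau of shape `outer / inner`: the value is `0`
on the boxes of the inner shape (empty boxes), `⊤` on the boxes outside the outer shape, and the
entry of the tableau on every other box. -/
abbrev SkewFilling : Type := ℕ → ℕ → WithTop ℕ

/-- Change the value of one box. -/
def SkewFilling.set (F : SkewFilling) (i j : ℕ) (v : WithTop ℕ) : SkewFilling :=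
  Function.update F i (Function.update (F i) j v)

/-- A jeu de taquin slide into the empty box `(i, j)`. The empty box is filled from whichever of the
boxes below it and to the right of it has the smaller value (the box below, if they are equal; the
one that lies in the outer shape, if only one does), and the box just vacated is treated in the same
way. When both these boxes lie outside the outer shape, the current box leaves the outer shape.
The first argument bounds the number of boxes visited; the number of boxes of the outer shape is
always enough, since a slide never visits a box twice. -/
def SkewFilling.slide : ℕ → SkewFilling → ℕ → ℕ → SkewFilling
  | 0, F, _, _ => F
  | N + 1, F, i, j =>
    if F (i + 1) j = ⊤ ∧ F i (j + 1) = ⊤ then F.set i j ⊤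
    else if F (i + 1) j ≤ F i (j + 1) then
      SkewFilling.slide N (F.set i j (F (i + 1) j)) (i + 1) j
    else
      SkewFilling.slide N (F.set i j (F i (j + 1))) i (j + 1)

/-- Rectification of a skew tableau whose inner shape consists of the first `a` boxes of row `0`.
At every stage the last remaining box of the inner shape is its only inner corner, so that the order
of the slides is forced: into `(0, a - 1)`, then `(0, a - 2)`, …, and finally `(0, 0)`. -/
def SkewFilling.rectify (N : ℕ) : ℕ → SkewFilling → SkewFilling
  | 0, F => F
  | a + 1, F => SkewFilling.rectify N a (SkewFilling.slide N F 0 a)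

/-- The skew tableau left when all the boxes that contain a `1` are deleted. -/
def deleteOnes (μ : YoungDiagram) (T : ℕ → ℕ → ℕ) : SkewFilling := fun i j =>
  if (i, j) ∈ μ then (if T i j = 1 then 0 else (T i j : WithTop ℕ)) else ⊤

/-- The number of boxes that contain a `1`. -/
def numOnes (μ : YoungDiagram) (T : ℕ → ℕ → ℕ) : ℕ :=
  (μ.cells.filter fun b => T b.1 b.2 = 1).card

/-- In a tableau with positive entries the boxes that contain a `1` are the first `numOnes` boxes of
row `0`, so that deleting them leaves an inner shape as required by `SkewFilling.rectify`. -/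
theorem SSYT.eq_one_iff {k : ℕ} {μ : YoungDiagram} (T : SSYT k μ) (i j : ℕ) :
    ((i, j) ∈ μ ∧ T.1 i j = 1) ↔ (i = 0 ∧ j < numOnes μ T.1) := by
  have row0 : ∀ {i j}, (i, j) ∈ μ → T.1 i j = 1 → i = 0 := by
    intro i j h h1
    by_contra hi
    have h2 := T.1.col_strict (Nat.pos_of_ne_zero hi) h
    have h3 := (T.2 0 j (μ.up_left_mem (Nat.zero_le i) le_rfl h)).1
    omega
  have left : ∀ {j j'}, j' ≤ j → (0, j) ∈ μ → T.1 0 j = 1 → (0, j') ∈ μ ∧ T.1 0 j' = 1 := by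
    intro j j' hj h h1
    have hm := μ.up_left_mem le_rfl hj h
    have h2 := T.1.row_weak_of_le hj h
    have h3 := (T.2 0 j' hm).1
    exact ⟨hm, by omega⟩
  set A := (μ.cells.filter fun b => T.1 b.1 b.2 = 1).image Prod.snd with hA
  have hmem : ∀ j, j ∈ A ↔ (0, j) ∈ μ ∧ T.1 0 j = 1 := by
    intro j
    simp only [hA, Finset.mem_image, Finset.mem_filter, YoungDiagram.mem_cells, Prod.exists]
    constructor
    · rintro ⟨a, b, ⟨h, h1⟩, rfl⟩
      have h0 := row0 h h1
      subst h0
      exact ⟨h, h1⟩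
    · rintro ⟨h, h1⟩
      exact ⟨0, j, ⟨h, h1⟩, rfl⟩
  have hcard : A.card = numOnes μ T.1 := by
    rw [hA, numOnes, Finset.card_image_of_injOn]
    rintro ⟨a, b⟩ h ⟨a', b'⟩ h' hb
    simp only [Finset.coe_filter, YoungDiagram.mem_cells, Set.mem_ofPred_eq] at h h'
    rw [Prod.mk.injEq, row0 h.1 h.2, row0 h'.1 h'.2]
    exact ⟨rfl, hb⟩
  have hrange : A = Finset.range A.card := by
    have hlow : ∀ j ∈ A, ∀ j' ≤ j, j' ∈ A := fun j hj j' hjj =>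
      (hmem j').2 (left hjj ((hmem j).1 hj).1 ((hmem j).1 hj).2)
    refine Finset.eq_of_subset_of_card_le (fun j hj => ?_) (by simp)
    have : Finset.range (j + 1) ⊆ A := fun x hx =>
      hlow j hj x (by simpa [Nat.lt_succ_iff] using hx)
    have := Finset.card_le_card this
    simp only [Finset.card_range] at this
    exact Finset.mem_range.2 (by omega)
  constructor
  · rintro ⟨h, h1⟩
    have h0 := row0 h h1
    subst h0
    have : j ∈ A := (hmem j).2 ⟨h, h1⟩
    rw [hrange, Finset.mem_range, hcard] at this
    exact ⟨rfl, this⟩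
  · rintro ⟨rfl, h⟩
    rw [← hcard, ← Finset.mem_range, ← hrange] at h
    exact (hmem j).1 h

/-- The entries of the promotion of a tableau `T` of shape `μ` with entries in `{1, …, k}`:
delete the boxes that contain a `1`, rectify, decrement all entries by `1`, and put a `k` into every
box of `μ` that is empty after the slides. (If `T` has no `1`, all entries are just decremented.)
As usual for tableaux in Mathlib, the value outside `μ` is `0`. -/
def promotionEntry (k : ℕ) (μ : YoungDiagram) (T : ℕ → ℕ → ℕ) (i j : ℕ) : ℕ :=
  let G := SkewFilling.rectify μ.card (numOnes μ T) (deleteOnes μ T)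
  if (i, j) ∈ μ then (if G i j = ⊤ then k else (G i j).untopD 0 - 1) else 0

/-- `P` is the promotion operator on `SSYT k μ`. At most one `P` has this property. -/
def IsPromotion {k : ℕ} {μ : YoungDiagram} (P : SSYT k μ → SSYT k μ) : Prop :=
  ∀ (T : SSYT k μ) (i j : ℕ), (P T).1 i j = promotionEntry k μ T.1 i j

/-- Rotation by 180 degrees of the boxes of the `m × n` rectangle. -/
def rotateBox {m n : ℕ} (b : Fin m × Fin n) : Fin m × Fin n := (b.1.rev, b.2.rev)

/-- The sum of the entries of `T` in the boxes of `S`. -/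
def entrySum {k m n : ℕ} (S : Finset (Fin m × Fin n)) (T : SSYT k (rectangle m n)) : ℂ :=
  ∑ b ∈ S, (T.1 b.1 b.2 : ℂ)

/-- The average of the statistic `ξ` on the orbit of `x` (meaningful when the orbit is finite). -/
noncomputable def orbitAverage (G : Type*) {X : Type*} [Group G] [MulAction G X] (ξ : X → ℂ)
    (x : X) : ℂ :=
  (∑ᶠ y ∈ MulAction.orbit G x, ξ y) / ((MulAction.orbit G x).ncard : ℂ)

/-- `(X, G, ξ)` is homomesic: all orbits are finite, and the average of `ξ` is the same on any two
orbits. -/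
def IsHomomesic (G : Type*) {X : Type*} [Group G] [MulAction G X] (ξ : X → ℂ) : Prop :=
  (∀ x : X, (MulAction.orbit G x).Finite) ∧
    ∀ x y : X, orbitAverage G ξ x = orbitAverage G ξ y

/-! Encode a tableau by its row counts: the number of entries at most `v` in row `r`. These form a
Gelfand–Tsetlin pattern, and column strictness makes a count `0` for `v ≤ r` and `n` for `v ≥ k - (m
- 1 - r)`, so for `m ≤ k` the free counts fill an `m × (k - m)` rectangle. On row counts, promotion
is a sequence of piecewise-linear toggles (`SSYT.rowCount_promote`). This is extracted from jeu de
taquin one slide at a time: the toggle identity relating the original counts to the current ones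
survives every slide (`SkewFilling.IsPartialRectification.slide`).

When row `r` is read off with a time delay that depends on `r`, the counts of the iterated
promotions become an orbit of piecewise-linear rowmotion on a product of two chains
(`SSYT.isPLOrbit_rowmotionOrbit`). Rowmotion there satisfies reciprocity: a label and the label of
the antipodal box at a suitable later time add up to `n`. This is proved for birational rowmotion,
where the product of the two labels is constant (`IsBirationalOrbit.reciprocity`), and passes to the
piecewise-linear version by comparing exponential growth rates (`IsPLOrbit.reciprocity`).

For tableaux reciprocity says that the entry of `T` in a box is at most `j` exactly when the entry
of the `j`-th promotion in the opposite box exceeds `k - j` (`SSYT.entry_le_iff`). An entry `e` is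
the number of `j < k` with `j < e`. Summing over an orbit and using its invariance to undo the
`j`-th promotion, the sum of the entries in a box becomes the sum of `k + 1 - e'`, with `e'` the
opposite entry. Opposite entries therefore add up to `k + 1` on average, and a set of boxes
invariant under rotation inherits the claim. -/

/-! ### Reciprocity for birational rowmotion, by weighted lattice paths. -/

/-- `h t x y`, for `1 ≤ x ≤ p` and `1 ≤ y ≤ q`, is an orbit of inverse birational rowmotion on the
product of two chains with `p` and `q` elements, with labels `1` and `B` attached below the least
and above the greatest element. The values around the rectangle are chosen so that the missing
neighbours contribute `0` to the sums (recall that `0⁻¹ = 0`). -/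
structure IsBirationalOrbit (p q : ℕ) (B : ℝ) (h : ℕ → ℕ → ℕ → ℝ) : Prop where
  B_pos : 0 < B
  pos : ∀ t {x y}, x < p → y < q → 0 < h t (x + 1) (y + 1)
  left : ∀ t y, h t 0 (y + 1) = if y = 0 then 1 else 0
  bot : ∀ t x, h t (x + 1) 0 = 0
  right : ∀ t y, h t (p + 1) (y + 1) = if y + 1 = q then B else 0
  top : ∀ t {x}, x < p → h t (x + 1) (q + 1) = 0
  step : ∀ t {x y}, x < p → y < q →
    h (t + 1) (x + 1) (y + 1) * h t (x + 1) (y + 1) *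
        ((h t (x + 2) (y + 1))⁻¹ + (h t (x + 1) (y + 2))⁻¹) =
      h (t + 1) x (y + 1) + h (t + 1) (x + 1) y

/-- `pathSum W i d y` is the sum, over all lattice paths from `(i + d - 1, y)` down to `(i, 1)`, of
the product of the weights `W` of the points visited. -/
def pathSum (W : ℕ → ℕ → ℝ) (i : ℕ) : ℕ → ℕ → ℝ
  | 0, y => if y = 1 then 1 else 0
  | _ + 1, 0 => 0
  | d + 1, y + 1 => W (i + d) (y + 1) * (pathSum W i (d + 1) y + pathSum W i d (y + 1))

/-- The ratio of a label to the sum of the labels below it. -/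
noncomputable def downWeight (g : ℕ → ℕ → ℝ) (x y : ℕ) : ℝ :=
  g x y / (g (x - 1) y + g x (y - 1))

/-- The ratio of the parallel sum of the labels above a point to its own label. -/
noncomputable def upWeight (g : ℕ → ℕ → ℝ) (x y : ℕ) : ℝ :=
  (g x y * ((g (x + 1) y)⁻¹ + (g x (y + 1))⁻¹))⁻¹

theorem pathSum_zero_right (W : ℕ → ℕ → ℝ) (i d : ℕ) : pathSum W i d 0 = 0 := by
  cases d <;> simp [pathSum]

theorem pathSum_congr {p q : ℕ} {W W' : ℕ → ℕ → ℝ}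
    (hW : ∀ x y, x < p → y < q → W (x + 1) (y + 1) = W' (x + 1) (y + 1)) (i : ℕ) :
    ∀ d y, i + d ≤ p → y ≤ q → pathSum W (i + 1) d y = pathSum W' (i + 1) d y := by
  intro d
  induction d with
  | zero => intro y _ _; simp [pathSum]
  | succ d ihd =>
    intro y hd
    induction y with
    | zero => intro _; simp [pathSum]
    | succ y ihy =>
      intro hy
      rw [pathSum, pathSum, ihy (by omega), ihd (y + 1) (by omega) hy,
        show i + 1 + d = (i + d) + 1 by ring, hW _ _ (by omega) (by omega)]

namespace IsBirationalOrbit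

variable {p q : ℕ} {B : ℝ} {h : ℕ → ℕ → ℕ → ℝ}

theorem lower_pos (H : IsBirationalOrbit p q B h) (t : ℕ) {x y : ℕ} (hx : x < p) (hy : y < q) :
    0 < h t x (y + 1) + h t (x + 1) y := by
  rcases x with _ | x <;> rcases y with _ | y
  · simp [H.left, H.bot]
  · have := H.pos t hx (show y < q by omega)
    rw [H.left]
    simpa using this
  · have := H.pos t (show x < p by omega) hy
    rw [H.bot]
    simpa using this
  · exact add_pos (H.pos t (by omega) hy) (H.pos t hx (by omega))

theorem upper_pos (H : IsBirationalOrbit p q B h) (t : ℕ) {x y : ℕ} (hx : x < p) (hy : y < q) :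
    0 < (h t (x + 2) (y + 1))⁻¹ + (h t (x + 1) (y + 2))⁻¹ := by
  have h1 := H.lower_pos (t + 1) hx hy
  rw [← H.step t hx hy] at h1
  exact pos_of_mul_pos_right h1 (mul_pos (H.pos _ hx hy) (H.pos _ hx hy)).le

/-- One step of the dynamics turns up-weights into down-weights. -/
theorem downWeight_succ (H : IsBirationalOrbit p q B h) (t : ℕ) {x y : ℕ} (hx : x < p)
    (hy : y < q) :
    downWeight (h (t + 1)) (x + 1) (y + 1) = upWeight (h t) (x + 1) (y + 1) := by
  have h1 := (H.lower_pos (t + 1) hx hy).ne'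
  have h2 := (H.upper_pos t hx hy).ne'
  have h3 := (H.pos t hx hy).ne'
  have h4 := (H.pos (t + 1) hx hy).ne'
  simp only [downWeight, upWeight, Nat.add_sub_cancel]
  rw [← H.step t hx hy, mul_assoc, div_mul_eq_div_div, div_self h4, one_div]

/-- By the definition of the down-weights, the labels satisfy the recursion of the path sums, with
the same boundary values. -/
theorem pathSum_downWeight (H : IsBirationalOrbit p q B h) (t : ℕ) :
    ∀ x y, x ≤ p → y < q → pathSum (downWeight (h t)) 1 x (y + 1) = h t x (y + 1) := by
  intro x
  induction x with
  | zero => intro y _ _; simp [pathSum, H.left]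
  | succ x ihx =>
    intro y hx
    induction y with
    | zero =>
      intro hy
      have h1 := (H.lower_pos t (show x < p by omega) hy).ne'
      rw [pathSum, pathSum, ihx 0 (by omega) hy]
      simp only [downWeight, show 1 + x = x + 1 by ring, Nat.add_sub_cancel]
      simp only [H.bot, zero_add, add_zero] at h1 ⊢
      exact div_mul_cancel₀ _ h1
    | succ y ihy =>
      intro hy
      have h1 := (H.lower_pos t (show x < p by omega) hy).ne'
      rw [pathSum, ihx (y + 1) (by omega) hy, ihy (by omega)]
      simp only [downWeight, show 1 + x = x + 1 by ring, Nat.add_sub_cancel]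
      rw [add_comm (h t (x + 1) (y + 1)), div_mul_cancel₀ _ h1]

/-- Partial sums of up-path sums divided by the labels of the next row. -/
noncomputable def partialSum (g : ℕ → ℕ → ℝ) (i d y : ℕ) : ℝ :=
  ∑ z ∈ Finset.range y, pathSum (upWeight g) i d z * (g (i + d) z)⁻¹

/-- Conservation of flow. An up-path sum divided by the label above its endpoint is the flow along
that edge; the up-weights are chosen so that the flow entering a point equals the flow leaving it.
The difference of the flows through two consecutive rows, up to column `y`, is what escapes to
column `y + 1`. -/
theorem partialSum_telescope (H : IsBirationalOrbit p q B h) (t : ℕ) {i d : ℕ} (hid : i + d < p) :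
    ∀ y, y ≤ q → partialSum (h t) (i + 1) d (y + 1) - partialSum (h t) (i + 1) (d + 1) (y + 1) =
      pathSum (upWeight (h t)) (i + 1) (d + 1) y * (h t (i + 1 + d) (y + 1))⁻¹ := by
  intro y
  induction y with
  | zero => intro _; simp [partialSum, pathSum_zero_right]
  | succ y ih =>
    intro hy
    have ih := ih (by omega)
    have e1 : i + 1 + d = (i + d) + 1 := by ring
    have h2 := (H.upper_pos t hid (show y < q by omega)).ne'
    have h3 := (H.pos t hid (show y < q by omega)).ne'
    unfold partialSum at ih ⊢
    rw [Finset.sum_range_succ _ (y + 1), Finset.sum_range_succ _ (y + 1)]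
    rw [add_sub_add_comm, ih, pathSum]
    rw [show i + 1 + (d + 1) = i + d + 2 by ring, e1]
    simp only [upWeight]
    rw [show i + d + 1 + 1 = i + d + 2 by ring, show y + 1 + 1 = y + 2 by ring]
    generalize (h t (i + d + 2) (y + 1))⁻¹ = u at *
    generalize (h t (i + d + 1) (y + 2))⁻¹ = v at *
    generalize pathSum (upWeight (h t)) (i + 1) (d + 1) y = a
    generalize pathSum (upWeight (h t)) (i + 1) d (y + 1) = b
    field_simp
    ring

/-- Nothing escapes beyond column `q`, where the inverse label is `0`, so the total flow is the same
through every row. -/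
theorem partialSum_full (H : IsBirationalOrbit p q B h) (hq : 0 < q) (t i : ℕ) :
    ∀ d, i + d ≤ p → partialSum (h t) (i + 1) d (q + 1) = (h t (i + 1) 1)⁻¹ := by
  intro d
  induction d with
  | zero =>
    intro _
    simp only [partialSum, pathSum, add_zero]
    rw [Finset.sum_eq_single 1]
    · simp
    · intro b _ hb; simp [hb]
    · intro h1; simp at h1; omega
  | succ d ih =>
    intro hd
    have h1 := H.partialSum_telescope t (show i + d < p by omega) q le_rfl
    rw [show i + 1 + d = (i + d) + 1 by ring, H.top t (by omega), inv_zero, mul_zero,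
      ih (by omega)] at h1
    linarith

/-- The path sums that end at a point of the lower boundary give the inverse label of that point. -/
theorem pathSum_upWeight (H : IsBirationalOrbit p q B h) (hq : 0 < q) (t : ℕ) {i d : ℕ}
    (hid : i + d = p) :
    pathSum (upWeight (h t)) (i + 1) d q = B * (h t (i + 1) 1)⁻¹ := by
  have h1 := H.partialSum_full hq t i d hid.le
  unfold partialSum at h1
  rw [Finset.sum_eq_single q] at h1
  · obtain ⟨q, rfl⟩ := Nat.exists_eq_succ_of_ne_zero hq.ne'
    rw [show i + 1 + d = p + 1 by omega, Nat.succ_eq_add_one, H.right, if_pos rfl] at h1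
    rw [← h1]
    have := H.B_pos.ne'
    field_simp
  · intro z hz hzq
    rcases z with _ | z
    · simp [pathSum_zero_right]
    · rw [show i + 1 + d = p + 1 by omega, H.right, if_neg hzq]
      simp
  · simp

/-- The bracket is the flow that crosses into row `i + 1 + d` in the columns from `y` on. Multiplied
by the label, it satisfies the recursion of the down-path sums, by conservation of flow. At `y = q`
a single term of the flow remains, which is what `pathSum_conversion` uses. -/
theorem pathSum_downWeight_eq (H : IsBirationalOrbit p q B h) (hq : 0 < q) (t i : ℕ) (hi : i < p) :
    ∀ d y, i + d < p → y ≤ q → pathSum (downWeight (h t)) (i + 2) d y =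
      h t (i + 1 + d) y * ((h t (i + 1) 1)⁻¹ - partialSum (h t) (i + 1) d y) := by
  have hc := (H.pos t hi hq).ne'
  intro d
  induction d with
  | zero =>
    intro y _ _
    rcases y with _ | _ | y
    · simp [pathSum, H.bot]
    · simp [pathSum, partialSum, hc]
    · have : partialSum (h t) (i + 1) 0 (y + 1 + 1) = (h t (i + 1) 1)⁻¹ := by
        simp only [partialSum, pathSum, add_zero]
        rw [Finset.sum_eq_single 1]
        · simp
        · intro b _ hb; simp [hb]
        · intro h1; simp at h1
      rw [this]
      simp [pathSum]
  | succ d ihd =>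
    intro y hd
    induction y with
    | zero =>
      intro _
      rw [pathSum_zero_right, show i + 1 + (d + 1) = i + d + 1 + 1 by ring, H.bot, zero_mul]
    | succ y ihy =>
      intro hy
      have ihy := ihy (by omega)
      have ihd := ihd (y + 1) (by omega) hy
      have htel := H.partialSum_telescope t (show i + d < p by omega) y (by omega)
      have hlow := (H.lower_pos t (show i + d + 1 < p by omega) (show y < q by omega)).ne'
      have hp := (H.pos t (show i + d < p by omega) (show y < q by omega)).ne'
      have hsucc : h t (i + 1 + (d + 1)) y * partialSum (h t) (i + 1) (d + 1) (y + 1) =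
          h t (i + 1 + (d + 1)) y * partialSum (h t) (i + 1) (d + 1) y +
            pathSum (upWeight (h t)) (i + 1) (d + 1) y := by
        conv_lhs => rw [partialSum, Finset.sum_range_succ, ← partialSum]
        rcases y with _ | y
        · simp [pathSum_zero_right]
        · have := (H.pos t (show i + d + 1 < p by omega) (show y < q by omega)).ne'
          rw [show i + 1 + (d + 1) = i + d + 1 + 1 by ring]
          field_simp
      rw [pathSum, ihy, ihd]
      simp only [downWeight, Nat.add_sub_cancel]
      rw [show i + 2 + d - 1 = i + d + 1 by omega, show i + 2 + d = i + d + 1 + 1 by omega]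
      rw [show i + 1 + (d + 1) = i + d + 1 + 1 by ring] at *
      rw [show i + 1 + d = i + d + 1 by ring] at *
      rw [eq_mul_inv_iff_mul_eq₀ hp] at htel
      rw [div_mul_eq_mul_div, div_eq_iff hlow, mul_assoc]
      congr 1
      linear_combination hsucc - htel

/-- Conversion of down-paths into up-paths one row below. -/
theorem pathSum_conversion (H : IsBirationalOrbit p q B h) (hq : 0 < q) (t : ℕ) {i d : ℕ}
    (hid : i + d < p) :
    pathSum (downWeight (h t)) (i + 2) d q = pathSum (upWeight (h t)) (i + 1) d q := by
  rw [H.pathSum_downWeight_eq hq t i (by omega) d q hid le_rfl]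
  have h1 := H.partialSum_full hq t i d hid.le
  rw [partialSum, Finset.sum_range_succ, ← partialSum] at h1
  rw [← h1, add_sub_cancel_left]
  obtain ⟨q, rfl⟩ := Nat.exists_eq_succ_of_ne_zero hq.ne'
  have := (H.pos t hid (Nat.lt_succ_self q)).ne'
  rw [show i + 1 + d = i + d + 1 by ring, Nat.succ_eq_add_one]
  field_simp

/-- Up-weights at time `t` are down-weights at time `t + 1`, and these convert back into up-weights
one row lower. Alternating the two lowers `i` by one at the cost of one unit of time, until the
paths end at `(1, 1)` and their sum is a label. -/
theorem pathSum_upWeight_eq (H : IsBirationalOrbit p q B h) (hq : 0 < q) {d : ℕ} :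
    ∀ i t, i + d ≤ p → pathSum (upWeight (h t)) (i + 1) d q = h (t + i + 1) d q := by
  have key : ∀ i t, i + d ≤ p → pathSum (upWeight (h t)) (i + 1) d q =
      pathSum (downWeight (h (t + 1))) (i + 1) d q := fun i t hid =>
    pathSum_congr (p := p) (q := q) (fun x y hx hy => (H.downWeight_succ t hx hy).symm) i d q hid
      le_rfl
  intro i
  induction i with
  | zero =>
    intro t hid
    obtain ⟨q, rfl⟩ := Nat.exists_eq_succ_of_ne_zero hq.ne'
    rw [key 0 t hid]
    exact H.pathSum_downWeight (t + 1) d q (by omega) (by omega)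
  | succ i ih =>
    intro t hid
    rw [key _ t hid, H.pathSum_conversion hq (t + 1) (by omega), ih (t + 1) (by omega)]
    congr 1
    ring

/-- The same up-path sum is evaluated in two ways: by the flow through row `p + 1`, and by transport
to row `1` at a later time. -/
theorem reciprocity_edge (H : IsBirationalOrbit p q B h) (hq : 0 < q) (t : ℕ) {x : ℕ} (hx : x < p) :
    h t (x + 1) 1 * h (t + x + 1) (p - x) q = B := by
  have h1 := H.pathSum_upWeight hq t (show x + (p - x) = p by omega)
  rw [H.pathSum_upWeight_eq hq x t (by omega)] at h1
  have := (H.pos t hx hq).ne'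
  rw [h1]
  field_simp

/-- Reciprocity for birational rowmotion on a rectangle. -/
theorem reciprocity (H : IsBirationalOrbit p q B h) :
    ∀ y, y < q → ∀ t x, x < p →
      h t (x + 1) (y + 1) * h (t + x + y + 1) (p - x) (q - y) = B := by
  intro y
  induction y using Nat.strong_induction_on with
  | _ y ih =>
  rcases y with _ | y
  · intro hq t x hx
    exact H.reciprocity_edge hq t hx
  · intro hy t x hx
    have hB := H.B_pos.ne'
    obtain ⟨x', hx'⟩ : ∃ x', p = x + x' + 1 := ⟨p - x - 1, by omega⟩
    obtain ⟨y', hy'⟩ : ∃ y', q = y + y' + 2 := ⟨q - y - 2, by omega⟩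
    -- The recurrence at `(x + 1, y + 1)` from time `t` and the one at the antipodal point from time
    -- `t + x + y + 1` correspond under reciprocity. The induction hypothesis, needed for both `y`
    -- and `y - 1`, matches all labels in them except `h t (x + 1) (y + 2)` and its partner, so
    -- these two match as well.
    have i0 := ih y (by omega) (by omega) t x hx
    have i1 := ih y (by omega) (by omega) (t + 1) x hx
    have r1 := H.step t hx (show y < q by omega)
    have r2 := H.step (t + x + y + 1) (show x' < p by omega) (show y' + 1 < q by omega)
    have p2 := H.pos (t + x + y + 2) (show x' < p by omega) (show y' < q by omega)
    have p3 := H.pos t hx hy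
    have p4 := H.pos t hx (show y < q by omega)
    have p5 := H.pos (t + 1) hx (show y < q by omega)
    have l1 : h (t + 1) x (y + 1) = B * (h (t + x + y + 1) (x' + 2) (y' + 2))⁻¹ := by
      rcases x with _ | x
      · rw [show x' + 2 = p + 1 by omega, H.left, H.right]
        by_cases hy0 : y = 0
        · rw [if_pos hy0, if_pos (by omega)]
          field_simp
        · rw [if_neg hy0, if_neg (by omega)]
          simp
      · have := ih y (by omega) (by omega) (t + 1) x (by omega)
        rw [show p - x = x' + 2 by omega, show q - y = y' + 2 by omega,
          show t + 1 + x + y + 1 = t + (x + 1) + y + 1 by ring] at this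
        exact (eq_mul_inv_iff_mul_eq₀ (right_ne_zero_of_mul (this ▸ hB))).2 this
    have l2 : h (t + 1) (x + 1) y = B * (h (t + x + y + 1) (x' + 1) (y' + 3))⁻¹ := by
      rcases y with _ | y
      · rw [H.bot, show y' + 3 = q + 1 by omega, H.top _ (by omega)]
        simp
      · have := ih y (by omega) (by omega) (t + 1) x (by omega)
        rw [show p - x = x' + 1 by omega, show q - y = y' + 3 by omega,
          show t + 1 + x + y + 1 = t + x + (y + 1) + 1 by ring] at this
        exact (eq_mul_inv_iff_mul_eq₀ (right_ne_zero_of_mul (this ▸ hB))).2 this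
    have u1 : B * (h t (x + 2) (y + 1))⁻¹ = h (t + x + y + 2) x' (y' + 2) := by
      rcases x' with _ | x'
      · rw [show x + 2 = p + 1 by omega, H.left, H.right, if_neg (by omega), if_neg (by omega)]
        simp
      · have := ih y (by omega) (by omega) t (x + 1) (by omega)
        rw [show p - (x + 1) = x' + 1 by omega, show q - y = y' + 2 by omega,
          show t + (x + 1) + y + 1 = t + x + y + 2 by ring, mul_comm] at this
        exact ((eq_mul_inv_iff_mul_eq₀ (right_ne_zero_of_mul (this ▸ hB))).2 this).symm
    rw [show p - x = x' + 1 by omega, show q - y = y' + 2 by omega] at i0 i1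
    rw [show t + 1 + x + y + 1 = t + x + y + 2 by ring] at i1
    rw [show p - x = x' + 1 by omega, show q - (y + 1) = y' + 1 by omega,
      show t + x + (y + 1) + 1 = t + x + y + 2 by ring]
    rw [show t + x + y + 1 + 1 = t + x + y + 2 by ring,
      show y' + 1 + 1 = y' + 2 by ring, show y' + 1 + 2 = y' + 3 by ring] at r2
    rw [l1, l2, ← mul_add] at r1
    rw [show y + 1 + 1 = y + 2 by ring] at *
    rw [← u1] at r2
    generalize (h (t + x + y + 1) (x' + 2) (y' + 2))⁻¹ = a at *
    generalize (h (t + x + y + 1) (x' + 1) (y' + 3))⁻¹ = b at *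
    generalize (h t (x + 2) (y + 1))⁻¹ = c at *
    generalize h (t + x + y + 2) (x' + 1) (y' + 1) = L at *
    have e : B * (h t (x + 1) (y + 2))⁻¹ = L := by
      have h3 : B * B * (a + b) = (h (t + 1) (x + 1) (y + 1) * h t (x + 1) (y + 1)) *
          (B * c + L) := by
        rw [← r2]
        nth_rewrite 1 [← i0]
        rw [← i1]
        ring
      have h4 : (h (t + 1) (x + 1) (y + 1) * h t (x + 1) (y + 1)) *
          (B * (h t (x + 1) (y + 2))⁻¹) =
          (h (t + 1) (x + 1) (y + 1) * h t (x + 1) (y + 1)) * L := by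
        linear_combination h3 + B * r1
      exact mul_left_cancel₀ (mul_pos p5 p4).ne' h4
    rw [← e]
    field_simp

end IsBirationalOrbit

/-! ### Existence of birational orbits with given positive initial labels. -/

open Filter Topology

/-- One step of inverse birational rowmotion, applied to the labelling `g`. -/
noncomputable def birationalStep (p q : ℕ) (B : ℝ) (g : ℕ → ℕ → ℝ) : ℕ → ℕ → ℝ
  | 0, y => if y = 1 then 1 else 0
  | _ + 1, 0 => 0
  | x + 1, y + 1 =>
    if x < p ∧ y < q then
      (birationalStep p q B g x (y + 1) + birationalStep p q B g (x + 1) y) /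
        (g (x + 1) (y + 1) * ((g (x + 2) (y + 1))⁻¹ + (g (x + 1) (y + 2))⁻¹))
    else if x = p ∧ y + 1 = q then B else 0

/-- The labelling with values `g` on the rectangle and the boundary values of
`IsBirationalOrbit`. -/
noncomputable def birationalInit (p q : ℕ) (B : ℝ) (g : ℕ → ℕ → ℝ) : ℕ → ℕ → ℝ
  | 0, y => if y = 1 then 1 else 0
  | _ + 1, 0 => 0
  | x + 1, y + 1 =>
    if x < p ∧ y < q then g (x + 1) (y + 1) else if x = p ∧ y + 1 = q then B else 0

/-- The orbit of inverse birational rowmotion that starts at `g`. -/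
noncomputable def birationalOrbit (p q : ℕ) (B : ℝ) (g : ℕ → ℕ → ℝ) : ℕ → ℕ → ℕ → ℝ
  | 0 => birationalInit p q B g
  | t + 1 => birationalStep p q B (birationalOrbit p q B g t)

section

variable {p q : ℕ} {B : ℝ} {g : ℕ → ℕ → ℝ}

theorem birationalOrbit_left (t y : ℕ) :
    birationalOrbit p q B g t 0 (y + 1) = if y = 0 then 1 else 0 := by
  cases t <;> simp [birationalOrbit, birationalInit, birationalStep]

theorem birationalOrbit_bot (t x : ℕ) : birationalOrbit p q B g t (x + 1) 0 = 0 := by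
  cases t <;> simp [birationalOrbit, birationalInit, birationalStep]

theorem birationalOrbit_right (t y : ℕ) :
    birationalOrbit p q B g t (p + 1) (y + 1) = if y + 1 = q then B else 0 := by
  cases t <;> simp [birationalOrbit, birationalInit, birationalStep]

theorem birationalOrbit_top (t x : ℕ) :
    birationalOrbit p q B g t (x + 1) (q + 1) = 0 := by
  cases t <;> simp [birationalOrbit, birationalInit, birationalStep]

theorem birationalOrbit_zero {x y : ℕ} (hx : x < p) (hy : y < q) :
    birationalOrbit p q B g 0 (x + 1) (y + 1) = g (x + 1) (y + 1) := by
  simp [birationalOrbit, birationalInit, hx, hy]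

theorem birationalOrbit_succ (t : ℕ) {x y : ℕ} (hx : x < p) (hy : y < q) :
    birationalOrbit p q B g (t + 1) (x + 1) (y + 1) =
      (birationalOrbit p q B g (t + 1) x (y + 1) + birationalOrbit p q B g (t + 1) (x + 1) y) /
        (birationalOrbit p q B g t (x + 1) (y + 1) *
          ((birationalOrbit p q B g t (x + 2) (y + 1))⁻¹ +
            (birationalOrbit p q B g t (x + 1) (y + 2))⁻¹)) := by
  rw [birationalOrbit, birationalStep, if_pos ⟨hx, hy⟩]

theorem birationalOrbit_upper_pos (hB : 0 < B) {t : ℕ}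
    (ht : ∀ x y, x < p → y < q → 0 < birationalOrbit p q B g t (x + 1) (y + 1)) {x y : ℕ}
    (hx : x < p) (hy : y < q) :
    0 < (birationalOrbit p q B g t (x + 2) (y + 1))⁻¹ +
      (birationalOrbit p q B g t (x + 1) (y + 2))⁻¹ := by
  have h1 : 0 ≤ (birationalOrbit p q B g t (x + 2) (y + 1))⁻¹ := by
    rcases Nat.lt_or_ge (x + 1) p with h | h
    · exact inv_nonneg.2 (ht _ _ h hy).le
    · rw [show x + 2 = p + 1 by omega, birationalOrbit_right]
      split_ifs
      · exact inv_nonneg.2 hB.le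
      · simp
  rcases Nat.lt_or_ge (y + 1) q with h | h
  · exact add_pos_of_nonneg_of_pos h1 (inv_pos.2 (ht _ _ hx h))
  · rw [show y + 2 = q + 1 by omega, birationalOrbit_top, inv_zero, add_zero]
    rcases Nat.lt_or_ge (x + 1) p with h' | h'
    · exact inv_pos.2 (ht _ _ h' hy)
    · rw [show x + 2 = p + 1 by omega, birationalOrbit_right, if_pos (by omega)]
      exact inv_pos.2 hB

theorem birationalOrbit_pos (hB : 0 < B) (hg : ∀ x y, 0 < g x y) :
    ∀ t x y, x < p → y < q → 0 < birationalOrbit p q B g t (x + 1) (y + 1) := by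
  intro t
  induction t with
  | zero => intro x y hx hy; rw [birationalOrbit_zero hx hy]; exact hg _ _
  | succ t ih =>
    intro x
    induction x with
    | zero =>
      intro y
      induction y with
      | zero =>
        intro hx hy
        rw [birationalOrbit_succ t hx hy, birationalOrbit_left, birationalOrbit_bot]
        have := ih _ _ hx hy
        have := birationalOrbit_upper_pos hB ih hx hy
        simp only [if_true]
        positivity
      | succ y ihy =>
        intro hx hy
        rw [birationalOrbit_succ t hx hy, birationalOrbit_left]
        have := ih _ _ hx hy
        have := birationalOrbit_upper_pos hB ih hx hy
        have := ihy hx (by omega)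
        simp only [Nat.add_eq_zero_iff, one_ne_zero, and_false, if_false]
        positivity
    | succ x ihx =>
      intro y
      induction y with
      | zero =>
        intro hx hy
        rw [birationalOrbit_succ t hx hy, birationalOrbit_bot]
        have := ih _ _ hx hy
        have := birationalOrbit_upper_pos hB ih hx hy
        have := ihx 0 (by omega) hy
        positivity
      | succ y ihy =>
        intro hx hy
        rw [birationalOrbit_succ t hx hy]
        have := ih _ _ hx hy
        have := birationalOrbit_upper_pos hB ih hx hy
        have := ihx (y + 1) (by omega) hy
        have := ihy hx (by omega)
        positivity

theorem isBirationalOrbit_birationalOrbit (hB : 0 < B) (hg : ∀ x y, 0 < g x y) :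
    IsBirationalOrbit p q B (birationalOrbit p q B g) where
  B_pos := hB
  pos t _ _ hx hy := birationalOrbit_pos hB hg t _ _ hx hy
  left := birationalOrbit_left
  bot := birationalOrbit_bot
  right := birationalOrbit_right
  top t x _ := birationalOrbit_top t x
  step t x y hx hy := by
    have h1 := (birationalOrbit_pos (p := p) (q := q) hB hg t _ _ hx hy).ne'
    have h2 := (birationalOrbit_upper_pos hB (birationalOrbit_pos hB hg t) hx hy).ne'
    rw [birationalOrbit_succ t hx hy, mul_assoc, div_mul_cancel₀ _ (mul_ne_zero h1 h2)]

end

/-! ### Tropicalization by exponential growth rates. -/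

/-- A sequence of positive reals with exponential growth rate `a`. -/
def HasGrowthRate (u : ℕ → ℝ) (a : ℝ) : Prop :=
  (∀ N, 0 < u N) ∧ Tendsto (fun N : ℕ => Real.log (u N) / N) atTop (𝓝 a)

namespace HasGrowthRate

variable {u v : ℕ → ℝ} {a b : ℝ}

theorem unique (hu : HasGrowthRate u a) (hv : HasGrowthRate u b) : a = b :=
  tendsto_nhds_unique hu.2 hv.2

theorem exp (a : ℝ) : HasGrowthRate (fun N => Real.exp (N * a)) a := by
  refine ⟨fun N => Real.exp_pos _, tendsto_const_nhds.congr' ?_⟩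
  filter_upwards [eventually_gt_atTop 0] with N hN
  have : (N : ℝ) ≠ 0 := by positivity
  rw [Real.log_exp]
  field_simp

theorem mul (hu : HasGrowthRate u a) (hv : HasGrowthRate v b) :
    HasGrowthRate (fun N => u N * v N) (a + b) := by
  refine ⟨fun N => mul_pos (hu.1 N) (hv.1 N), (hu.2.add hv.2).congr fun N => ?_⟩
  rw [Real.log_mul (hu.1 N).ne' (hv.1 N).ne', add_div]

theorem inv (hu : HasGrowthRate u a) : HasGrowthRate (fun N => (u N)⁻¹) (-a) := by
  refine ⟨fun N => inv_pos.2 (hu.1 N), hu.2.neg.congr fun N => ?_⟩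
  rw [Real.log_inv, neg_div]

/-- The logarithm of a sum exceeds the larger of the two logarithms by at most `log 2`, which
vanishes after division by `N`. -/
theorem add (hu : HasGrowthRate u a) (hv : HasGrowthRate v b) :
    HasGrowthRate (fun N => u N + v N) (max a b) := by
  refine ⟨fun N => add_pos (hu.1 N) (hv.1 N), ?_⟩
  have h1 := hu.2.max hv.2
  have h2 : Tendsto (fun N : ℕ => Real.log 2 / N) atTop (𝓝 0) :=
    tendsto_const_div_atTop_nhds_zero_nat _
  have h3 := h1.add h2
  rw [add_zero] at h3
  refine tendsto_of_tendsto_of_tendsto_of_le_of_le h1 h3 (fun N => ?_) (fun N => ?_)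
  · have pu := hu.1 N
    have pv := hv.1 N
    refine max_le ?_ ?_ <;> refine div_le_div_of_nonneg_right (Real.log_le_log ?_ ?_) (by positivity)
      <;> linarith
  · have pu := hu.1 N
    have pv := hv.1 N
    have hle : Real.log (u N + v N) ≤ max (Real.log (u N)) (Real.log (v N)) + Real.log 2 := by
      rcases le_total (u N) (v N) with h | h
      · have := Real.log_le_log (by positivity) (show u N + v N ≤ v N * 2 by linarith)
        rw [Real.log_mul pv.ne' (by norm_num)] at this
        linarith [le_max_right (Real.log (u N)) (Real.log (v N))]
      · have := Real.log_le_log (by positivity) (show u N + v N ≤ u N * 2 by linarith)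
        rw [Real.log_mul pu.ne' (by norm_num)] at this
        linarith [le_max_left (Real.log (u N)) (Real.log (v N))]
    have := div_le_div_of_nonneg_right hle (Nat.cast_nonneg' (α := ℝ) N)
    rw [add_div, ← max_div_div_right (Nat.cast_nonneg' (α := ℝ) N)] at this
    exact this

end HasGrowthRate

/-! ### Piecewise-linear rowmotion. -/

/-- `H t x y`, for `1 ≤ x ≤ p` and `1 ≤ y ≤ q`, is an orbit of inverse piecewise-linear rowmotion on
the product of two chains with `p` and `q` elements, with values between `0` and `n`. -/
structure IsPLOrbit (p q n : ℕ) (H : ℕ → ℕ → ℕ → ℕ) : Prop where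
  le : ∀ t {x y}, x < p → y < q → H t (x + 1) (y + 1) ≤ n
  left : ∀ t y, H t 0 (y + 1) = 0
  bot : ∀ t x, H t (x + 1) 0 = 0
  right : ∀ t {y}, y < q → H t (p + 1) (y + 1) = n
  top : ∀ t {x}, x < p → H t (x + 1) (q + 1) = n
  step : ∀ t {x y}, x < p → y < q →
    H (t + 1) (x + 1) (y + 1) + H t (x + 1) (y + 1) =
      min (H t (x + 2) (y + 1)) (H t (x + 1) (y + 2)) +
        max (H (t + 1) x (y + 1)) (H (t + 1) (x + 1) y)

namespace IsPLOrbit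

variable {p q n : ℕ} {H : ℕ → ℕ → ℕ → ℕ}

/-- The birational orbits whose exponential growth rates are given by `H`. -/
noncomputable def lift (p q n : ℕ) (H : ℕ → ℕ → ℕ → ℕ) (N : ℕ) : ℕ → ℕ → ℕ → ℝ :=
  birationalOrbit p q (Real.exp (N * (n : ℝ))) (fun x y => Real.exp (N * (H 0 x y : ℝ)))

theorem isBirationalOrbit_lift (N : ℕ) :
    IsBirationalOrbit p q (Real.exp (N * (n : ℝ))) (lift p q n H N) :=
  isBirationalOrbit_birationalOrbit (Real.exp_pos _) fun _ _ => Real.exp_pos _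

/-- On most of the upper boundary the birational inverse label is `0` and drops out of the sum,
whereas the piecewise-linear label is `n`. The two agree because `n` never affects a minimum with a
label that is at most `n`; only at the corner `(p, q)` does the value `n` matter, and there it comes
from `B`. -/
theorem growth_upper (hH : IsPLOrbit p q n H) {t : ℕ}
    (ht : ∀ x y, x < p → y < q →
      HasGrowthRate (fun N => lift p q n H N t (x + 1) (y + 1)) (H t (x + 1) (y + 1)))
    {x y : ℕ} (hx : x < p) (hy : y < q) :
    HasGrowthRate (fun N => (lift p q n H N t (x + 2) (y + 1))⁻¹ +
        (lift p q n H N t (x + 1) (y + 2))⁻¹)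
      (-(min (H t (x + 2) (y + 1)) (H t (x + 1) (y + 2)) : ℕ)) := by
  have hL := isBirationalOrbit_lift (p := p) (q := q) (n := n) (H := H)
  rcases Nat.lt_or_ge (x + 1) p with h | h <;> rcases Nat.lt_or_ge (y + 1) q with h' | h'
  · convert (ht _ _ h hy).inv.add (ht _ _ hx h').inv using 1
    rw [max_neg_neg, Nat.cast_min]
  · have e : ∀ N, lift p q n H N t (x + 1) (y + 2) = 0 := fun N => by
      rw [show y + 2 = q + 1 by omega, (hL N).top _ hx]
    rw [show y + 2 = q + 1 by omega, hH.top t hx, min_eq_left (hH.le t h hy)]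
    simp only [show q + 1 = y + 2 by omega, e, inv_zero, add_zero]
    exact (ht _ _ h hy).inv
  · have e : ∀ N, lift p q n H N t (x + 2) (y + 1) = 0 := fun N => by
      rw [show x + 2 = p + 1 by omega, (hL N).right, if_neg (by omega)]
    rw [show x + 2 = p + 1 by omega, hH.right t hy, min_eq_right (hH.le t hx h')]
    simp only [show p + 1 = x + 2 by omega, e, inv_zero, zero_add]
    exact (ht _ _ hx h').inv
  · have e : ∀ N, lift p q n H N t (x + 1) (y + 2) = 0 := fun N => by
      rw [show y + 2 = q + 1 by omega, (hL N).top _ hx]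
    have e' : ∀ N : ℕ, lift p q n H N t (x + 2) (y + 1) = Real.exp (N * (n : ℝ)) := fun N => by
      rw [show x + 2 = p + 1 by omega, (hL N).right, if_pos (by omega)]
    simp only [e, e', inv_zero, add_zero]
    rw [show x + 2 = p + 1 by omega, show y + 2 = q + 1 by omega, hH.right t hy, hH.top t hx,
      min_self]
    exact (HasGrowthRate.exp _).inv

theorem growth_succ (hH : IsPLOrbit p q n H) {t : ℕ}
    (ht : ∀ x y, x < p → y < q →
      HasGrowthRate (fun N => lift p q n H N t (x + 1) (y + 1)) (H t (x + 1) (y + 1)))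
    {x y : ℕ} (hx : x < p) (hy : y < q)
    (hlow : HasGrowthRate (fun N => lift p q n H N (t + 1) x (y + 1) +
        lift p q n H N (t + 1) (x + 1) y)
      (max (H (t + 1) x (y + 1)) (H (t + 1) (x + 1) y) : ℕ)) :
    HasGrowthRate (fun N => lift p q n H N (t + 1) (x + 1) (y + 1))
      (H (t + 1) (x + 1) (y + 1)) := by
  have h1 := hlow.mul ((ht x y hx hy).mul (hH.growth_upper ht hx hy)).inv
  convert h1 using 1
  · funext N
    exact birationalOrbit_succ t hx hy
  · have := hH.step t hx hy
    have : (H (t + 1) (x + 1) (y + 1) : ℝ) + H t (x + 1) (y + 1) =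
      (min (H t (x + 2) (y + 1)) (H t (x + 1) (y + 2)) : ℕ) +
        (max (H (t + 1) x (y + 1)) (H (t + 1) (x + 1) y) : ℕ) := by exact_mod_cast this
    linarith

theorem growth (hH : IsPLOrbit p q n H) :
    ∀ t x y, x < p → y < q →
      HasGrowthRate (fun N => lift p q n H N t (x + 1) (y + 1)) (H t (x + 1) (y + 1)) := by
  have hL := isBirationalOrbit_lift (p := p) (q := q) (n := n) (H := H)
  intro t
  induction t with
  | zero =>
    intro x y hx hy
    simp only [lift, birationalOrbit_zero hx hy]
    exact HasGrowthRate.exp _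
  | succ t ih =>
    intro x
    induction x with
    | zero =>
      intro y
      induction y with
      | zero =>
        intro hx hy
        refine hH.growth_succ ih hx hy ?_
        simp only [(hL _).left, (hL _).bot, hH.left, hH.bot, if_true]
        simpa using HasGrowthRate.exp 0
      | succ y ihy =>
        intro hx hy
        refine hH.growth_succ ih hx hy ?_
        simp only [(hL _).left, hH.left, Nat.add_eq_zero_iff, one_ne_zero, and_false, if_false,
          zero_add, zero_le, max_eq_right]
        exact ihy hx (by omega)
    | succ x ihx =>
      intro y
      induction y with
      | zero =>
        intro hx hy
        refine hH.growth_succ ih hx hy ?_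
        simp only [(hL _).bot, hH.bot, add_zero, zero_le, max_eq_left]
        exact ihx 0 (by omega) hy
      | succ y ihy =>
        intro hx hy
        refine hH.growth_succ ih hx hy ?_
        rw [Nat.cast_max]
        exact (ihx (y + 1) (by omega) hy).add (ihy hx (by omega))

/-- Reciprocity for piecewise-linear rowmotion on a rectangle. -/
theorem reciprocity (hH : IsPLOrbit p q n H) (t : ℕ) {x y : ℕ} (hx : x < p) (hy : y < q) :
    H t (x + 1) (y + 1) + H (t + x + y + 1) (p - x) (q - y) = n := by
  have h1 := hH.growth t x y hx hy
  have h2 := hH.growth (t + x + y + 1) (p - x - 1) (q - y - 1) (by omega) (by omega)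
  rw [show p - x - 1 + 1 = p - x by omega, show q - y - 1 + 1 = q - y by omega] at h2
  have h3 := h1.mul h2
  simp only [(isBirationalOrbit_lift _).reciprocity y hy t x hx] at h3
  exact_mod_cast h3.unique (HasGrowthRate.exp (n : ℝ))

end IsPLOrbit

/-! ### Jeu de taquin in terms of row counts. -/

namespace SkewFilling

theorem set_apply (F : SkewFilling) (i j : ℕ) (v : WithTop ℕ) (r c : ℕ) :
    F.set i j v r c = if r = i ∧ c = j then v else F r c := by
  by_cases hr : r = i
  · subst hr
    by_cases hc : c = j <;> simp [set, Function.update, hc]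
  · simp [set, Function.update, hr]

/-- `F'` arises from `F` by a slide into an empty box of row `i` that holds the value `w`. Here
`κ v r` is the number of boxes of row `r` of `F` with values at most `v`, and the number of
such boxes drops by one in row `ρ v` for every `v ≥ w`. -/
structure IsSlide (κ : ℕ → ℕ → ℕ) (ρ : ℕ → ℕ) (w i : ℕ) (F F' : SkewFilling) : Prop where
  low : ∀ v < w, ∀ r c, F' r c ≤ v ↔ F r c ≤ v
  start : ρ w = i
  next : ∀ v ≥ w, ρ (v + 1) = if κ (v + 1) (ρ v + 1) = κ v (ρ v) then ρ v + 1 else ρ v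
  pos : ∀ v ≥ w, 0 < κ v (ρ v)
  high : ∀ v ≥ w, ∀ r c, F' r c ≤ v ↔ c < κ v r - if r = ρ v then 1 else 0

/-- One move of the hole, which pulls in the value `w'`. For the thresholds `v` with `w ≤ v < w'`,
the shape of the values at most `v` loses the box `(i, j)` now, so the path `ρ` is `i` there; from
`w'` on, the rest of the slide decides. -/
theorem IsSlide.prepend {κ : ℕ → ℕ → ℕ} {ρ : ℕ → ℕ} {w w' i i' j : ℕ} {F F' : SkewFilling}
    (h : IsSlide κ ρ w' i' (F.set i j w') F') (hw : w ≤ w') (hF : F i j = w)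
    (hκ : ∀ v ≥ w, ∀ r c, F r c ≤ v ↔ c < κ v r)
    (hi : w = w' → i' = i)
    (hcol : ∀ v, w ≤ v → v < w' → κ v i = j + 1)
    (hstay : ∀ v, w ≤ v → v + 1 < w' → κ (v + 1) (i + 1) ≠ κ v i)
    (hmove : ∀ v, w ≤ v → v + 1 = w' → i' = if κ (v + 1) (i + 1) = κ v i then i + 1 else i) :
    ∃ ρ, IsSlide κ ρ w i F F' := by
  refine ⟨fun v => if v < w' then i else ρ v, ?_, ?_, ?_, ?_, ?_⟩
  · intro v hv r c
    rw [h.low v (by omega), set_apply]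
    split_ifs with hrc
    · rw [hrc.1, hrc.2, hF]
      simp only [Nat.cast_le]
      omega
    · rfl
  · by_cases hww : w < w'
    · simp [hww]
    · have : w = w' := by omega
      subst this
      simpa using h.start.trans (hi rfl)
  · intro v hv
    by_cases h1 : v + 1 < w'
    · rw [if_pos h1, if_pos (show v < w' by omega), if_neg (hstay v hv h1)]
    · by_cases h2 : v < w'
      · have h3 : v + 1 = w' := by omega
        rw [if_neg h1, if_pos h2, h3, h.start, hmove v hv h3, h3]
      · rw [if_neg h1, if_neg h2]
        exact h.next v (by omega)
  · intro v hv
    by_cases h2 : v < w'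
    · simp [h2, hcol v hv h2]
    · simpa [h2] using h.pos v (by omega)
  · intro v hv r c
    by_cases h2 : v < w'
    · simp only [h2, if_true]
      rw [h.low v h2, set_apply]
      split_ifs with hrc hr hr
      · have := hcol v hv h2
        rw [hr, this]
        simp only [Nat.cast_le]
        omega
      · exact absurd hrc.1 hr
      · have := hcol v hv h2
        rw [hκ v hv, hr, this]
        have : c ≠ j := fun hc => hrc ⟨hr, hc⟩
        omega
      · rw [hκ v hv, Nat.sub_zero]
    · simpa [h2] using h.high v (by omega) r c

/-- At threshold `v` the hole sits at the end of its row. It moves down for the value `v + 1`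
exactly when the box below also has a value at most `v + 1`, which for column-strict counts is the
equality of counts in `IsSlide.next`; otherwise it travels right past the entries `v + 1`. The bound
on `N` holds because each move increases `i + j`. -/
theorem exists_isSlide {m n : ℕ} (κ : ℕ → ℕ → ℕ) : ∀ (N : ℕ) (F : SkewFilling) (i j w : ℕ),
    (∀ r c, F r c ≠ ⊤ → r < m ∧ c < n) → m + n ≤ i + j + N + 1 → F i j = w →
    (∀ r c, F r c ≤ F r (c + 1)) → (w < F (i + 1) j) →
    (∀ v ≥ w, ∀ r c, F r c ≤ v ↔ c < κ v r) →
    (∀ v ≥ w, ∀ r ≥ i, κ (v + 1) (r + 1) ≤ κ v r) →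
    ∃ ρ, IsSlide κ ρ w i F (slide N F i j) := by
  intro N
  induction N with
  | zero =>
    intro F i j w hbox hN hF
    have := hbox i j (by simp [hF])
    omega
  | succ N ih =>
    intro F i j w hbox hN hF hrow hdown hκ hs
    have hright : (w : WithTop ℕ) ≤ F i (j + 1) := hF ▸ hrow i j
    have hij : ∀ v ≥ w, j < κ v i := fun v hv => by
      rw [← hκ v hv, hF]
      exact_mod_cast hv
    -- The box that becomes the next hole keeps its old value `w'`, so the counts `κ` still describe
    -- the filling, but only for thresholds `v ≥ w'`.
    have hnew : ∀ w' : ℕ, w ≤ w' → (w' : WithTop ℕ) ≤ F i (j + 1) →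
        (∀ r c, F.set i j w' r c ≠ ⊤ → r < m ∧ c < n) ∧
        (∀ r c, F.set i j w' r c ≤ F.set i j w' r (c + 1)) ∧
        (∀ v ≥ w', ∀ r c, F.set i j w' r c ≤ v ↔ c < κ v r) := by
      intro w' hw hle
      refine ⟨fun r c hrc => ?_, fun r c => ?_, fun v hv r c => ?_⟩
      · rw [set_apply] at hrc
        split_ifs at hrc with h
        · rw [h.1, h.2]
          exact hbox i j (by simp [hF])
        · exact hbox r c hrc
      · rw [set_apply, set_apply]
        split_ifs with h h' h'
        · omega
        · rw [h.1, h.2]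
          exact hle
        · have := hrow r c
          rw [h'.1, h'.2, hF] at this
          rw [h'.1]
          exact this.trans (by exact_mod_cast hw)
        · exact hrow r c
      · rw [set_apply]
        split_ifs with h
        · rw [h.1, h.2]
          have := hij v (by omega)
          simp only [Nat.cast_le]
          omega
        · exact hκ v (by omega) r c
    have below_gt : ∀ v : ℕ, w ≤ v → (v : WithTop ℕ) < F (i + 1) j → κ v (i + 1) ≤ j := by
      intro v hv hlt
      by_contra hc
      exact absurd ((hκ v hv (i + 1) j).2 (by omega)) (not_le.2 hlt)
    have right_gt : ∀ v : ℕ, w ≤ v → (v : WithTop ℕ) < F i (j + 1) → κ v i = j + 1 := by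
      intro v hv hlt
      have h1 : ¬ j + 1 < κ v i := fun hc =>
        absurd ((hκ v hv i (j + 1)).2 hc) (not_le.2 hlt)
      have := hij v hv
      omega
    rw [slide]
    split_ifs with h1 h2
    · have hr : ∀ v ≥ w, κ v i = j + 1 := fun v hv =>
        right_gt v hv (h1.2 ▸ WithTop.coe_lt_top v)
      have hb : ∀ v ≥ w, κ v (i + 1) ≤ j := fun v hv =>
        below_gt v hv (h1.1 ▸ WithTop.coe_lt_top v)
      refine ⟨fun _ => i, fun v hv r c => ?_, rfl, fun v hv => ?_, fun v hv => ?_,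
        fun v hv r c => ?_⟩
      · rw [set_apply]
        split_ifs with h
        · rw [h.1, h.2, hF]
          simp only [Nat.cast_le, top_le_iff, WithTop.natCast_ne_top, false_iff]
          omega
        · rfl
      · have := hr v hv
        have := hb (v + 1) (by omega)
        rw [if_neg (by omega)]
      · have := hr v hv
        omega
      · rw [set_apply]
        split_ifs with h h' h'
        · rw [h', hr v hv]
          simp only [top_le_iff, WithTop.natCast_ne_top, false_iff]
          omega
        · exact absurd h.1 h'
        · have : c ≠ j := fun hc => h ⟨h', hc⟩
          rw [hκ v hv, h', hr v hv]
          omega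
        · rw [hκ v hv, Nat.sub_zero]
    · have hne : F (i + 1) j ≠ ⊤ := fun h => h1 ⟨h, top_le_iff.1 (h ▸ h2)⟩
      obtain ⟨w', hw'⟩ := WithTop.ne_top_iff_exists.1 hne
      have hw' : F (i + 1) j = (w' : WithTop ℕ) := hw'.symm
      rw [hw'] at h2 hdown ⊢
      have hww : w < w' := by exact_mod_cast hdown
      obtain ⟨n1, n2, n3⟩ := hnew w' hww.le h2
      have hge : ∀ v, w ≤ v → v < w' → κ v (i + 1) ≤ j := fun v hv hv' =>
        below_gt v hv (by rw [hw']; exact_mod_cast hv')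
      have hcol : ∀ v, w ≤ v → v < w' → κ v i = j + 1 := fun v hv hv' =>
        right_gt v hv (lt_of_lt_of_le (by exact_mod_cast hv') h2)
      obtain ⟨ρ, hρ⟩ := ih (F.set i j w') (i + 1) j w' n1 (by omega)
        (by rw [set_apply, if_neg (by omega), hw']) n2
        (by
          rw [set_apply, if_neg (by omega), ← not_le, hκ w' hww.le]
          obtain ⟨u, rfl⟩ : ∃ u, w' = u + 1 := ⟨w' - 1, by omega⟩
          have := hs u (by omega) (i + 1) (by omega)
          have := hge u (by omega) (by omega)
          omega) n3
        (fun v hv r hr => hs v (by omega) r (by omega))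
      refine hρ.prepend hww.le hF hκ (by omega) hcol (fun v hv hv' => ?_) (fun v hv hv' => ?_)
      · have := hge (v + 1) (by omega) hv'
        have := hcol v hv (by omega)
        omega
      · have h5 := (hκ w' hww.le (i + 1) j).1 hw'.le
        have := hs v hv i le_rfl
        have := hcol v hv (by omega)
        rw [← hv'] at h5
        rw [if_pos (by omega)]
    · rw [not_le] at h2
      obtain ⟨w', hw'⟩ := WithTop.ne_top_iff_exists.1 (ne_top_of_lt h2)
      have hw' : F i (j + 1) = (w' : WithTop ℕ) := hw'.symm
      rw [hw'] at h2 hright ⊢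
      have hww : w ≤ w' := by exact_mod_cast hright
      obtain ⟨n1, n2, n3⟩ := hnew w' hww hw'.ge
      have hb : ∀ v, w ≤ v → v ≤ w' → κ v (i + 1) ≤ j := fun v hv hv' =>
        below_gt v hv (lt_of_le_of_lt (by exact_mod_cast hv') h2)
      have hcol : ∀ v, w ≤ v → v < w' → κ v i = j + 1 := fun v hv hv' =>
        right_gt v hv (by rw [hw']; exact_mod_cast hv')
      obtain ⟨ρ, hρ⟩ := ih (F.set i j w') i (j + 1) w' n1 (by omega)
        (by rw [set_apply, if_neg (by omega), hw']) n2
        (by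
          rw [set_apply, if_neg (by omega), ← not_le, hκ w' hww]
          have := hb w' hww le_rfl
          omega) n3
        (fun v hv r hr => hs v (by omega) r (by omega))
      refine hρ.prepend hww hF hκ (fun _ => rfl) hcol (fun v hv hv' => ?_) (fun v hv hv' => ?_)
      · have := hb (v + 1) (by omega) (by omega)
        have := hcol v hv (by omega)
        omega
      · have := hb (v + 1) (by omega) (by omega)
        have := hcol v hv (by omega)
        rw [if_neg (by omega)]

/-- `κ v r` is the number of boxes of row `r` with values at most `v`, and these boxes come first
in the row. -/
def HasRowCounts (F : SkewFilling) (κ : ℕ → ℕ → ℕ) : Prop :=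
  ∀ (v r c : ℕ), F r c ≤ v ↔ c < κ v r

/-- The number of boxes with values at most `v` in row `r - 1`, capped by the number `b` of such
boxes allowed in row `r`; there is no cap from above for row `0`. -/
def capAbove (a : ℕ → ℕ) (b : ℕ) : ℕ → ℕ
  | 0 => b
  | r + 1 => min (a r) b

/-- The row counts `κ` arise from `κ₀` by some of the slides of a rectification; `σ v` bounds the
rows that these slides have affected. -/
structure IsPartialRectification (κ₀ κ : ℕ → ℕ → ℕ) (σ : ℕ → ℕ) : Prop where
  le : ∀ v r, κ v r ≤ κ₀ v r
  zero : ∀ r, κ 0 (r + 1) = 0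
  toggle : ∀ v r, κ (v + 1) r + κ₀ v r =
    capAbove (κ v) (κ₀ (v + 1) r) r + max (κ v r) (κ₀ (v + 1) (r + 1))
  bound : ∀ v r, σ v < r → κ v r = κ₀ v r
  bound_zero : σ 0 = 0
  bound_succ : ∀ v, σ (v + 1) ≤ σ v ∨
    (σ (v + 1) = σ v + 1 ∧ κ v (σ v) ≤ κ₀ (v + 1) (σ v + 1))

theorem IsPartialRectification.col_strict {κ₀ κ : ℕ → ℕ → ℕ} {σ : ℕ → ℕ}
    (h : IsPartialRectification κ₀ κ σ) (h₀ : ∀ v r, κ₀ (v + 1) (r + 1) ≤ κ₀ v r) (v r : ℕ) :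
    κ (v + 1) (r + 1) ≤ κ v r := by
  have h1 := h.toggle v (r + 1)
  have h2 := h.le v (r + 1)
  have h3 := h₀ v (r + 1)
  simp only [capAbove] at h1
  omega

/-- A slide lowers `κ v (ρ v)` by one. According to whether this count exceeds `κ₀ (v + 1) (ρ v +
1)` or not, the drop shows in the maximum of the toggle identity for row `ρ v` or in the minimum of
the one for row `ρ v + 1`. This is the same dichotomy as whether the path stays in its row or moves
down, so the identity is preserved. -/
theorem IsPartialRectification.slide {κ₀ κ : ℕ → ℕ → ℕ} {σ ρ : ℕ → ℕ} {F F' : SkewFilling}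
    (h : IsPartialRectification κ₀ κ σ) (h₀ : ∀ v r, κ₀ (v + 1) (r + 1) ≤ κ₀ v r)
    (hF : IsSlide κ ρ 0 0 F F') :
    IsPartialRectification κ₀ (fun v r => κ v r - if r = ρ v then 1 else 0) ρ := by
  have hpos : ∀ v, 0 < κ v (ρ v) := fun v => hF.pos v (Nat.zero_le v)
  have hnext : ∀ v, ρ (v + 1) = if κ (v + 1) (ρ v + 1) = κ v (ρ v) then ρ v + 1 else ρ v :=
    fun v => hF.next v (Nat.zero_le v)
  -- Row `ρ v + 1` is still untouched at level `v`, so the toggle identity reduces `κ (v + 1) (ρ v +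
  -- 1)` to `min (κ v (ρ v)) (κ₀ (v + 1) (ρ v + 1))`.
  have hmove : ∀ v, σ v ≤ ρ v →
      (κ (v + 1) (ρ v + 1) = κ v (ρ v) ↔ κ v (ρ v) ≤ κ₀ (v + 1) (ρ v + 1)) := by
    intro v hv
    have h1 := h.toggle v (ρ v + 1)
    have h2 := h.bound v (ρ v + 1) (by omega)
    have h3 := h₀ v (ρ v + 1)
    simp only [capAbove] at h1
    omega
  -- Paths of successive slides do not cross. Where they share a row and the earlier one moved down,
  -- the later one must too, since the criterion compares a count that has only decreased with a
  -- fixed number.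
  have hσ : ∀ v, σ v ≤ ρ v := by
    intro v
    induction v with
    | zero => rw [h.bound_zero]; exact Nat.zero_le _
    | succ v ih =>
      have h1 := hnext v
      have h2 := hmove v ih
      rcases h.bound_succ v with h3 | ⟨h3, h4⟩
      · split_ifs at h1 <;> omega
      · rcases ih.lt_or_eq with h5 | h5
        · split_ifs at h1 <;> omega
        · rw [h5] at h4
          rw [if_pos (h2.2 h4)] at h1
          omega
  constructor
  · intro v r
    exact (Nat.sub_le _ _).trans (h.le v r)
  · intro r
    simp [h.zero r]
  · intro v r
    have h1 := hnext v
    have h2 := hmove v (hσ v)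
    have h3 := hpos v
    have h4 := h.toggle v r
    have h5 := hpos (v + 1)
    have h6 := h.bound v (ρ v + 1) (Nat.lt_succ_of_le (hσ v))
    have hcap : ∀ s b, capAbove (fun r => κ v r - if r = s then 1 else 0) b s =
        capAbove (κ v) b s := by
      rintro (_ | s) b <;> simp [capAbove]
    by_cases hr : r = ρ v
    · subst hr
      rw [hcap]
      generalize capAbove (κ v) (κ₀ (v + 1) (ρ v)) (ρ v) = e at *
      rw [if_pos rfl]
      split_ifs at h1 with h7
      · rw [h1, if_neg (by omega)]
        have := h2.1 h7
        omega
      · rw [h1] at h5 ⊢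
        rw [if_pos rfl]
        have := mt h2.2 h7
        omega
    · rcases r with _ | s
      · rw [if_neg hr, if_neg (by split_ifs at h1 <;> omega)]
        simpa only [capAbove, Nat.sub_zero] using h4
      · simp only [capAbove] at h4 ⊢
        rw [if_neg hr]
        by_cases hs : s = ρ v
        · subst hs
          rw [if_pos rfl]
          split_ifs at h1 with h7
          · rw [h1] at h5 ⊢
            rw [if_pos rfl]
            have := h2.1 h7
            omega
          · rw [h1, if_neg (by omega)]
            have := mt h2.2 h7
            omega
        · rw [if_neg hs, if_neg (by split_ifs at h1 <;> omega)]
          exact h4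
  · intro v r hr
    rw [if_neg (by omega), Nat.sub_zero]
    exact h.bound v r (lt_of_le_of_lt (hσ v) hr)
  · exact hF.start
  · intro v
    have h1 := hnext v
    split_ifs at h1 with h2
    · right
      have := (hmove v (hσ v)).1 h2
      refine ⟨h1, ?_⟩
      omega
    · left
      omega

theorem IsPartialRectification.refl {κ₀ : ℕ → ℕ → ℕ} (h₀ : ∀ v r, κ₀ (v + 1) (r + 1) ≤ κ₀ v r)
    (hz : ∀ r, κ₀ 0 (r + 1) = 0) (hmono : ∀ v r, κ₀ v r ≤ κ₀ (v + 1) r) :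
    IsPartialRectification κ₀ κ₀ (fun _ => 0) where
  le _ _ := le_rfl
  zero := hz
  toggle v r := by
    have h1 := h₀ v r
    rcases r with _ | r
    · simp only [capAbove]
      omega
    · have h2 := h₀ v r
      have h3 := hmono v (r + 1)
      simp only [capAbove]
      omega
  bound _ _ _ := rfl
  bound_zero := rfl
  bound_succ _ := Or.inl le_rfl

theorem exists_rectify_rowCounts {m n N : ℕ} {κ₀ : ℕ → ℕ → ℕ} (hN : m + n ≤ N + 1)
    (h₀ : ∀ v r, κ₀ (v + 1) (r + 1) ≤ κ₀ v r) :
    ∀ (a : ℕ) (F : SkewFilling) (κ : ℕ → ℕ → ℕ) (σ : ℕ → ℕ), F.HasRowCounts κ →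
      IsPartialRectification κ₀ κ σ → (∀ v r, 0 < κ v r → r < m) → (∀ v r, κ v r ≤ n) →
      κ 0 0 = a →
      ∃ κ' σ', (rectify N a F).HasRowCounts κ' ∧ IsPartialRectification κ₀ κ' σ' ∧ κ' 0 0 = 0 := by
  intro a
  induction a with
  | zero => intro F κ σ hF h _ _ h0; exact ⟨κ, σ, hF, h, h0⟩
  | succ a ih =>
    intro F κ σ hF h hm hn h0
    have hzero : F 0 a = (0 : ℕ) := by
      have := (hF 0 0 a).2 (by omega)
      simpa using this
    obtain ⟨ρ, hρ⟩ := exists_isSlide (m := m) (n := n) κ N F 0 a 0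
      (fun r c hrc => by
        obtain ⟨u, hu⟩ := WithTop.ne_top_iff_exists.1 hrc
        have h1 := (hF u r c).1 hu.ge
        exact ⟨hm u r (by omega), lt_of_lt_of_le h1 (hn u r)⟩)
      (by omega) hzero
      (fun r c => by
        rcases eq_or_ne (F r (c + 1)) ⊤ with h1 | h1
        · rw [h1]; exact le_top
        · obtain ⟨u, hu⟩ := WithTop.ne_top_iff_exists.1 h1
          have h2 := (hF u r (c + 1)).1 hu.ge
          rw [← hu]
          exact (hF u r c).2 (by omega))
      (by
        rw [← not_le, hF 0 1 a, h.zero 0]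
        omega)
      (fun v _ => hF v) (fun v _ r _ => h.col_strict h₀ v r)
    refine ih _ _ _ (fun v r c => hρ.high v (Nat.zero_le v) r c) (h.slide h₀ hρ)
      (fun v r hr => hm v r (by omega)) (fun v r => (Nat.sub_le _ _).trans (hn v r)) ?_
    rw [hρ.start, if_pos rfl]
    omega

end SkewFilling

/-! ### Row counts of rectangular tableaux and of their promotions. -/

theorem mem_rectangle {m n i j : ℕ} : (i, j) ∈ rectangle m n ↔ i < m ∧ j < n := by
  rw [← YoungDiagram.mem_cells]
  simp [rectangle]

theorem Finset.mem_iff_lt_card_of_isLowerSet {A : Finset ℕ} (hA : IsLowerSet (A : Set ℕ)) (c : ℕ) :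
    c ∈ A ↔ c < A.card := by
  have hrange : A = Finset.range A.card := by
    refine Finset.eq_of_subset_of_card_le (fun j hj => ?_) (by simp)
    have : Finset.range (j + 1) ⊆ A := fun x hx =>
      hA (show x ≤ j by simpa [Nat.lt_succ_iff] using hx) hj
    have := Finset.card_le_card this
    simp only [Finset.card_range] at this
    exact Finset.mem_range.2 (by omega)
  rw [← Finset.mem_range, ← hrange]

namespace SSYT

variable {k m n : ℕ}

theorem ext' {μ : YoungDiagram} {T T' : SSYT k μ} (h : ∀ i j, (i, j) ∈ μ → T.1 i j = T'.1 i j) :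
    T = T' := by
  refine Subtype.ext (SemistandardYoungTableau.ext fun i j => ?_)
  by_cases hij : (i, j) ∈ μ
  · exact h i j hij
  · rw [T.1.zeros hij, T'.1.zeros hij]

instance : Finite (SSYT k (rectangle m n)) := by
  refine Finite.of_injective (β := Fin m → Fin n → Fin (k + 1))
    (fun T i j => ⟨T.1 i j, Nat.lt_succ_of_le (T.2 i j (mem_rectangle.2 ⟨i.2, j.2⟩)).2⟩) ?_
  intro T T' h
  refine ext' fun i j hij => ?_
  obtain ⟨hi, hj⟩ := mem_rectangle.1 hij
  have := congrFun (congrFun h ⟨i, hi⟩) ⟨j, hj⟩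
  simpa using this

/-- The number of entries at most `v` in row `r`. -/
def rowCount (T : SSYT k (rectangle m n)) (v r : ℕ) : ℕ :=
  ((Finset.range n).filter fun c => r < m ∧ T.1 r c ≤ v).card

variable (T : SSYT k (rectangle m n))

theorem lt_rowCount {v r c : ℕ} : c < T.rowCount v r ↔ r < m ∧ c < n ∧ T.1 r c ≤ v := by
  rw [rowCount, ← Finset.mem_iff_lt_card_of_isLowerSet]
  · simp only [Finset.mem_filter, Finset.mem_range]
    tauto
  · intro a b hba ha
    simp only [Finset.coe_filter, Finset.mem_range, Set.mem_ofPred_eq] at ha ⊢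
    refine ⟨by omega, ha.2.1, ?_⟩
    exact (T.1.row_weak_of_le hba (mem_rectangle.2 ⟨ha.2.1, ha.1⟩)).trans ha.2.2

theorem rowCount_le (v r : ℕ) : T.rowCount v r ≤ n :=
  le_of_forall_lt fun _ hc => (T.lt_rowCount.1 hc).2.1

theorem rowCount_mono {v v' : ℕ} (hv : v ≤ v') (r : ℕ) : T.rowCount v r ≤ T.rowCount v' r :=
  le_of_forall_lt fun _ hc => by
    rw [lt_rowCount] at hc ⊢
    exact ⟨hc.1, hc.2.1, hc.2.2.trans hv⟩

theorem rowCount_of_le {v r : ℕ} (hr : m ≤ r) : T.rowCount v r = 0 := by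
  by_contra h
  have := T.lt_rowCount.1 (Nat.pos_of_ne_zero h)
  omega

theorem rowCount_zero (r : ℕ) : T.rowCount 0 r = 0 := by
  by_contra h
  obtain ⟨h1, h2, h3⟩ := T.lt_rowCount.1 (Nat.pos_of_ne_zero h)
  have := (T.2 r 0 (mem_rectangle.2 ⟨h1, h2⟩)).1
  omega

theorem rowCount_succ_succ_le (v r : ℕ) : T.rowCount (v + 1) (r + 1) ≤ T.rowCount v r :=
  le_of_forall_lt fun c hc => by
    rw [lt_rowCount] at hc ⊢
    have := T.1.col_strict (show r < r + 1 by omega) (mem_rectangle.2 ⟨hc.1, hc.2.1⟩)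
    exact ⟨by omega, hc.2.1, by omega⟩

theorem rowCount_of_ge {v r : ℕ} (hv : k ≤ v) (hr : r < m) : T.rowCount v r = n := by
  refine le_antisymm (T.rowCount_le v r) (le_of_forall_lt fun c hc => ?_)
  rw [lt_rowCount]
  exact ⟨hr, hc, (T.2 r c (mem_rectangle.2 ⟨hr, hc⟩)).2.trans hv⟩

/-- Iterated interlacing along a diagonal; it yields the two triangles of the pattern where the
count is forced to be `0` or `n`. -/
theorem rowCount_add_le (d v r : ℕ) : T.rowCount (v + d) (r + d) ≤ T.rowCount v r := by
  induction d with
  | zero => exact le_rfl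
  | succ d ih => exact (T.rowCount_succ_succ_le _ _).trans ih

theorem rowCount_eq_zero {v r : ℕ} (h : v ≤ r) : T.rowCount v r = 0 := by
  have := T.rowCount_add_le v 0 (r - v)
  rw [T.rowCount_zero, Nat.zero_add, Nat.sub_add_cancel h] at this
  omega

theorem rowCount_eq_full {v r d : ℕ} (hr : r + d < m) (h : k ≤ v + d) : T.rowCount v r = n := by
  have := T.rowCount_add_le d v r
  rw [T.rowCount_of_ge h hr] at this
  exact le_antisymm (T.rowCount_le v r) this

theorem eq_of_rowCount_eq {T T' : SSYT k (rectangle m n)}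
    (h : ∀ v r, T.rowCount v r = T'.rowCount v r) : T = T' := by
  refine ext' fun i j hij => ?_
  obtain ⟨hi, hj⟩ := mem_rectangle.1 hij
  have key : ∀ v, T.1 i j ≤ v ↔ T'.1 i j ≤ v := fun v => by
    have h1 := T.lt_rowCount (v := v) (r := i) (c := j)
    have h2 := T'.lt_rowCount (v := v) (r := i) (c := j)
    rw [h] at h1
    tauto
  exact le_antisymm ((key _).2 le_rfl) ((key _).1 le_rfl)

/-- The row counts of the skew tableau left when the boxes that contain a `1` are deleted. -/
theorem deleteOnes_hasRowCounts :
    (deleteOnes (rectangle m n) T.1).HasRowCounts fun v r => T.rowCount (max v 1) r := by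
  intro v r c
  rw [lt_rowCount, deleteOnes]
  by_cases h : (r, c) ∈ rectangle m n
  · have h1 := (T.2 r c h).1
    rw [if_pos h]
    obtain ⟨hr, hc⟩ := mem_rectangle.1 h
    split_ifs with h2
    · simp [hr, hc, h2]
    · simp only [Nat.cast_le, hr, hc, true_and]
      omega
  · rw [if_neg h]
    rw [mem_rectangle] at h
    simp only [top_le_iff, WithTop.natCast_ne_top, false_iff]
    tauto

theorem numOnes_eq : numOnes (rectangle m n) T.1 = T.rowCount 1 0 := by
  have key : ∀ c, c < numOnes (rectangle m n) T.1 ↔ c < T.rowCount 1 0 := fun c => by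
    have h1 := T.eq_one_iff 0 c
    rw [lt_rowCount]
    rw [mem_rectangle] at h1
    constructor
    · intro h
      obtain ⟨h2, h3⟩ := h1.2 ⟨rfl, h⟩
      exact ⟨h2.1, h2.2, h3.le⟩
    · rintro ⟨h2, h3, h4⟩
      have := (T.2 0 c (mem_rectangle.2 ⟨h2, h3⟩)).1
      exact (h1.1 ⟨⟨h2, h3⟩, by omega⟩).2
  exact le_antisymm (le_of_forall_lt fun c => (key c).1) (le_of_forall_lt fun c => (key c).2)

open SkewFilling in
theorem exists_rowCounts_rectify : ∃ (κ : ℕ → ℕ → ℕ) (σ : ℕ → ℕ),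
    (rectify (rectangle m n).card (numOnes (rectangle m n) T.1)
      (deleteOnes (rectangle m n) T.1)).HasRowCounts κ ∧
    IsPartialRectification (fun v r => T.rowCount (max v 1) r) κ σ ∧ κ 0 0 = 0 := by
  have hcol : ∀ v r, T.rowCount (max (v + 1) 1) (r + 1) ≤ T.rowCount (max v 1) r := fun v r => by
    rw [max_eq_left (by omega)]
    exact (T.rowCount_succ_succ_le v r).trans (T.rowCount_mono (le_max_left _ _) r)
  have hrefl := IsPartialRectification.refl (κ₀ := fun v r => T.rowCount (max v 1) r) hcol
    (fun r => T.rowCount_eq_zero (by simp)) (fun v r => T.rowCount_mono (by omega) r)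
  have hD := T.deleteOnes_hasRowCounts
  rw [numOnes_eq]
  rcases Nat.eq_zero_or_pos (T.rowCount 1 0) with h0 | h0
  · rw [h0]
    exact ⟨_, _, hD, hrefl, h0⟩
  · have hmn := T.lt_rowCount.1 h0
    refine exists_rectify_rowCounts (m := m) (n := n) ?_ hcol _ _ _ _ hD hrefl ?_ ?_ rfl
    -- The number of boxes bounds the length of a slide: `m + n ≤ m * n + 1` for positive `m` and
    -- `n`.
    · have : (rectangle m n).card = m * n := by simp [YoungDiagram.card, rectangle]
      rw [this]
      obtain ⟨m, rfl⟩ : ∃ m', m = m' + 1 := ⟨m - 1, by omega⟩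
      obtain ⟨n, rfl⟩ : ∃ n', n = n' + 1 := ⟨n - 1, by omega⟩
      ring_nf
      omega
    · intro v r h
      exact (T.lt_rowCount.1 h).1
    · exact fun v r => T.rowCount_le _ r

theorem promotionEntry_of_notMem {i j : ℕ} (h : (i, j) ∉ rectangle m n) :
    promotionEntry k (rectangle m n) T.1 i j = 0 := by
  simp [promotionEntry, h]

/-- The row counts of the promotion, and their relation to those of the tableau. -/
theorem exists_rowCounts_promotionEntry : ∃ κ : ℕ → ℕ → ℕ,
    (∀ {r c}, r < m → c < n → 1 ≤ promotionEntry k (rectangle m n) T.1 r c ∧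
      promotionEntry k (rectangle m n) T.1 r c ≤ k) ∧
    (∀ {v r c}, v < k → r < m → c < n →
      (promotionEntry k (rectangle m n) T.1 r c ≤ v ↔ c < κ v r)) ∧
    (∀ v r, κ (v + 1) (r + 1) ≤ κ v r) ∧
    (∀ {v r}, k ≤ v + 1 → r + 1 < m → κ v r = n) ∧
    (∀ v r, κ v r ≤ T.rowCount (v + 1) r) ∧
    (∀ v r, κ (v + 1) r + T.rowCount (v + 1) r =
      SkewFilling.capAbove (κ v) (T.rowCount (v + 2) r) r +
        max (κ v r) (T.rowCount (v + 2) (r + 1))) := by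
  obtain ⟨κ, σ, hG, hκ, h00⟩ := T.exists_rowCounts_rectify
  have hκ0 : ∀ r, κ 0 r = 0 := fun r => by
    cases r with
    | zero => exact h00
    | succ r => exact hκ.zero r
  have hcol : ∀ v r, T.rowCount (max (v + 1) 1) (r + 1) ≤ T.rowCount (max v 1) r := fun v r => by
    rw [max_eq_left (by omega)]
    exact (T.rowCount_succ_succ_le v r).trans (T.rowCount_mono (le_max_left _ _) r)
  -- Deleted boxes count as `0`, so the original counts at levels `0` and `1` agree; after
  -- rectification nothing of value at most `1` is left.
  have hκ1 : ∀ r, κ 1 r = 0 := fun r => by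
    have h1 := hκ.toggle 0 r
    simp only [zero_add, max_self, zero_le, max_eq_right, hκ0] at h1
    rw [T.rowCount_eq_zero (show 1 ≤ r + 1 by omega)] at h1
    cases r with
    | zero =>
      simp only [SkewFilling.capAbove] at h1
      omega
    | succ r =>
      simp only [SkewFilling.capAbove, hκ0] at h1
      omega
  -- Rectification removes only a horizontal strip from the shape at each level.
  have hstrip : ∀ v r, T.rowCount (max v 1) (r + 1) ≤ κ v r := by
    intro v
    induction v with
    | zero => intro r; rw [T.rowCount_eq_zero (by simp)]; exact Nat.zero_le _
    | succ v ih =>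
      intro r
      have h1 := hκ.toggle v r
      have h2 := T.rowCount_mono (show max v 1 ≤ max (v + 1) 1 by omega) r
      cases r with
      | zero =>
        simp only [SkewFilling.capAbove] at h1
        omega
      | succ r =>
        have h3 := ih r
        simp only [SkewFilling.capAbove] at h1
        omega
  -- From level `k` on the original counts are constant, so the toggle identity lets no new value
  -- above `k` appear.
  have hbig : ∀ v r, k ≤ v → 1 ≤ v → κ (v + 1) r ≤ κ v r := by
    intro v r hv hv1
    have h1 := hκ.toggle v r
    have h2 := hstrip v r
    have h3 : T.rowCount (max (v + 1) 1) (r + 1) = T.rowCount (max v 1) (r + 1) := by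
      rcases Nat.lt_or_ge (r + 1) m with h | h
      · rw [T.rowCount_of_ge (by omega) h, T.rowCount_of_ge (by omega) h]
      · rw [T.rowCount_of_le h, T.rowCount_of_le h]
    have h4 : T.rowCount (max (v + 1) 1) r = T.rowCount (max v 1) r := by
      rcases Nat.lt_or_ge r m with h | h
      · rw [T.rowCount_of_ge (by omega) h, T.rowCount_of_ge (by omega) h]
      · rw [T.rowCount_of_le h, T.rowCount_of_le h]
    rw [h3, h4] at h1
    cases r with
    | zero =>
      simp only [SkewFilling.capAbove] at h1
      omega
    | succ r =>
      simp only [SkewFilling.capAbove] at h1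
      omega
  have hk : ∀ {r c}, r < m → c < n → 1 ≤ k := fun hr hc =>
    let h := T.2 _ _ (mem_rectangle.2 ⟨hr, hc⟩)
    h.1.trans h.2
  have hle : ∀ {v r c}, v < k → r < m → c < n →
      (promotionEntry k (rectangle m n) T.1 r c ≤ v ↔ c < κ (v + 1) r) := by
    intro v r c hv hr hc
    have hm := mem_rectangle.2 ⟨hr, hc⟩
    rw [← hG, promotionEntry]
    simp only [hm, if_true]
    split_ifs with htop
    · rw [htop]
      simp only [top_le_iff, WithTop.natCast_ne_top, iff_false]
      omega
    · obtain ⟨g, hg⟩ := WithTop.ne_top_iff_exists.1 htop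
      rw [← hg, WithTop.untopD_coe]
      change _ ↔ ((g : ℕ) : WithTop ℕ) ≤ ((v + 1 : ℕ) : WithTop ℕ)
      rw [Nat.cast_le]
      omega
  -- The index shift reflects the final decrease of all entries by one. Vacated boxes receive `k`,
  -- so only the levels `v < k` are compared.
  refine ⟨fun v r => κ (v + 1) r, fun {r c} hr hc => ⟨?_, ?_⟩, hle, fun v r => ?_, ?_, ?_, ?_⟩
  · by_contra h
    have := (hle (hk hr hc) hr hc).1 (show _ ≤ 0 by omega)
    rw [hκ1] at this
    omega
  · have hm := mem_rectangle.2 ⟨hr, hc⟩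
    rw [promotionEntry]
    simp only [hm, if_true]
    split_ifs with htop
    · exact le_rfl
    · obtain ⟨g, hg⟩ := WithTop.ne_top_iff_exists.1 htop
      rw [← hg, WithTop.untopD_coe]
      by_contra hgk
      obtain ⟨g, rfl⟩ : ∃ g', g = g' + 1 := ⟨g - 1, by omega⟩
      have h1 := (hG (g + 1) r c).1 hg.ge
      have h2 := hbig g r (by omega) (by have := hk hr hc; omega)
      have h3 := (hG g r c).2 (by omega)
      rw [← hg] at h3
      change ((g + 1 : ℕ) : WithTop ℕ) ≤ (g : WithTop ℕ) at h3
      rw [Nat.cast_le] at h3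
      omega
  · exact hκ.col_strict hcol (v + 1) r
  · intro v r hv hr
    have h1 := hstrip (v + 1) r
    rw [T.rowCount_of_ge (by omega) hr] at h1
    exact le_antisymm ((hκ.le (v + 1) r).trans (T.rowCount_le _ r)) h1
  · intro v r
    have := hκ.le (v + 1) r
    simpa using this
  · intro v r
    have := hκ.toggle (v + 1) r
    simpa using this

/-- Promotion as an operator on semistandard tableaux of rectangular shape. -/
def promote : SSYT k (rectangle m n) :=
  ⟨{ entry := promotionEntry k (rectangle m n) T.1
     row_weak' := by
      intro i j₁ j₂ hj hm
      obtain ⟨hi, hj2⟩ := mem_rectangle.1 hm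
      obtain ⟨κ, hpos, hle, -⟩ := T.exists_rowCounts_promotionEntry
      rcases Nat.lt_or_ge (promotionEntry k (rectangle m n) T.1 i j₂) k with h | h
      · exact (hle h hi (by omega)).2 (hj.trans ((hle h hi hj2).1 le_rfl))
      · exact (hpos hi (by omega)).2.trans h
     col_strict' := by
      obtain ⟨κ, hpos, hle, hcol, hfull, -⟩ := T.exists_rowCounts_promotionEntry
      have step : ∀ i j, i + 1 < m → j < n → promotionEntry k (rectangle m n) T.1 i j <
          promotionEntry k (rectangle m n) T.1 (i + 1) j := by
        intro i j hi hj
        obtain ⟨v, hv⟩ : ∃ v, promotionEntry k (rectangle m n) T.1 (i + 1) j = v + 1 :=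
          ⟨_, (Nat.succ_pred_eq_of_pos (hpos hi hj).1).symm⟩
        have hvk := (hpos hi hj).2
        rw [hv] at hvk ⊢
        refine Nat.lt_succ_of_le ((hle hvk (by omega) hj).2 ?_)
        rcases Nat.lt_or_ge (v + 1) k with h | h
        · exact lt_of_lt_of_le ((hle h hi hj).1 hv.le) (hcol v i)
        · rw [hfull h hi]
          exact hj
      intro i₁ i₂ j hi hm
      obtain ⟨hi2, hj⟩ := mem_rectangle.1 hm
      clear hm
      induction i₂, hi using Nat.le_induction with
      | base => exact step i₁ j hi2 hj
      | succ i _ ih => exact (ih (by omega)).trans (step i j hi2 hj)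
     zeros' := fun hm => T.promotionEntry_of_notMem hm },
   by
    obtain ⟨κ, hpos, -⟩ := T.exists_rowCounts_promotionEntry
    intro i j hm
    obtain ⟨hi, hj⟩ := mem_rectangle.1 hm
    exact hpos hi hj⟩

theorem promote_apply (i j : ℕ) :
    T.promote.1 i j = promotionEntry k (rectangle m n) T.1 i j := rfl

/-- In terms of row counts, promotion is a sequence of piecewise-linear toggles. -/
theorem rowCount_promote {v : ℕ} (hv : v + 1 < k) (r : ℕ) :
    T.promote.rowCount (v + 1) r + T.rowCount (v + 1) r =
      SkewFilling.capAbove (T.promote.rowCount v) (T.rowCount (v + 2) r) r +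
        max (T.promote.rowCount v r) (T.rowCount (v + 2) (r + 1)) := by
  obtain ⟨κ, -, hle, -, -, hκ, htoggle⟩ := T.exists_rowCounts_promotionEntry
  have key : ∀ u, u < k → ∀ r, T.promote.rowCount u r = κ u r := by
    intro u hu r
    have : ∀ c, c < T.promote.rowCount u r ↔ c < κ u r := by
      intro c
      rw [lt_rowCount, promote_apply]
      constructor
      · rintro ⟨hr, hc, h⟩
        exact (hle hu hr hc).1 h
      · intro h
        obtain ⟨hr, hc, -⟩ := T.lt_rowCount.1 (h.trans_le (hκ u r))
        exact ⟨hr, hc, (hle hu hr hc).2 h⟩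
    exact le_antisymm (le_of_forall_lt fun c => (this c).1) (le_of_forall_lt fun c => (this c).2)
  rw [key _ hv, show T.promote.rowCount v = κ v from funext (key v (by omega))]
  exact htoggle v r

/-- Each toggle is reversible: the counts of `T` are recovered from those of its promotion by
descending from level `k`, where they are forced. -/
theorem promote_injective :
    Function.Injective (promote : SSYT k (rectangle m n) → SSYT k (rectangle m n)) := by
  intro T T' h
  have key : ∀ d v, k ≤ v + d → ∀ r, T.rowCount v r = T'.rowCount v r := by
    intro d
    induction d with
    | zero =>
      intro v hv r
      rcases Nat.lt_or_ge r m with hr | hr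
      · rw [T.rowCount_of_ge (by omega) hr, T'.rowCount_of_ge (by omega) hr]
      · rw [T.rowCount_of_le hr, T'.rowCount_of_le hr]
    | succ d ih =>
      intro v hv r
      rcases v with _ | v
      · rw [T.rowCount_zero, T'.rowCount_zero]
      · rcases Nat.lt_or_ge (v + 1) k with hk | hk
        · have h1 := T.rowCount_promote hk r
          have h2 := T'.rowCount_promote hk r
          rw [h, ih (v + 2) (by omega) r, ih (v + 2) (by omega) (r + 1), ← h2] at h1
          omega
        · exact ih (v + 1) (by omega) r
  exact eq_of_rowCount_eq fun v r => key k v (by omega) r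

/-- Promotion as a permutation. -/
noncomputable def promotion (k m n : ℕ) : Equiv.Perm (SSYT k (rectangle m n)) :=
  Equiv.ofBijective promote (Finite.injective_iff_bijective.1 promote_injective)

theorem promotion_apply : promotion k m n T = T.promote := rfl

theorem isPromotion_promotion : IsPromotion (promotion k m n) := fun _ _ _ => rfl

end SSYT

/-! ### Promotion as rowmotion, and homomesy. -/

namespace SSYT

variable {k m n : ℕ} (T : SSYT k (rectangle m n))

/-- The row counts of the iterated promotions of `T`, arranged as an orbit of piecewise-linear
rowmotion on the product of chains with `m` and `k - m` elements. -/
noncomputable def rowmotionOrbit (t x y : ℕ) : ℕ :=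
  if x = 0 ∨ y = 0 then 0 else if m < x ∨ k - m < y then n else
    ((promotion k m n ^ (t + x - 1)) T).rowCount (m - x + y) (m - x)

theorem rowmotionOrbit_of_le (t : ℕ) {x y : ℕ} (hx : x < m) (hy : y < k - m) :
    T.rowmotionOrbit t (x + 1) (y + 1) =
      ((promotion k m n ^ (t + x)) T).rowCount (m - x + y) (m - x - 1) := by
  rw [rowmotionOrbit, if_neg (by omega), if_neg (by omega)]
  congr 1
  omega

/-- Promotion updates a count from new counts at level `v` and old ones at level `v + 2`, in
neighbouring rows. The delay by `x` promotions in row `m - x` turns this mixture of old and new into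
the one that rowmotion uses. -/
theorem isPLOrbit_rowmotionOrbit : IsPLOrbit m (k - m) n T.rowmotionOrbit where
  le t x y hx hy := by
    rw [T.rowmotionOrbit_of_le t hx hy]
    exact rowCount_le _ _ _
  left t y := by simp [rowmotionOrbit]
  bot t x := by simp [rowmotionOrbit]
  right t y _ := by simp [rowmotionOrbit]
  top t x _ := by simp [rowmotionOrbit]
  step t x y hx hy := by
    obtain ⟨r, hr⟩ : ∃ r, m = r + x + 1 := ⟨m - x - 1, by omega⟩
    set U := (promotion k m n ^ (t + x)) T with hU
    have hU' : (promotion k m n ^ (t + x + 1)) T = U.promote := by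
      rw [pow_succ', Equiv.Perm.mul_apply, promotion_apply]
    have h1 := U.rowCount_promote (show r + y + 1 < k by omega) r
    have e1 : T.rowmotionOrbit (t + 1) (x + 1) (y + 1) = U.promote.rowCount (r + y + 1) r := by
      rw [T.rowmotionOrbit_of_le _ hx hy, ← hU', show t + 1 + x = t + x + 1 by ring]
      congr 1 <;> omega
    have e2 : T.rowmotionOrbit t (x + 1) (y + 1) = U.rowCount (r + y + 1) r := by
      rw [T.rowmotionOrbit_of_le _ hx hy]
      congr 1 <;> omega
    have e3 : T.rowmotionOrbit t (x + 1) (y + 2) = U.rowCount (r + y + 2) r := by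
      rcases Nat.lt_or_ge (y + 1) (k - m) with h | h
      · rw [T.rowmotionOrbit_of_le _ hx h]
        congr 1 <;> omega
      · rw [U.rowCount_eq_full (d := x) (by omega) (by omega), rowmotionOrbit, if_neg (by omega),
          if_pos (by omega)]
    have e4 : T.rowmotionOrbit (t + 1) (x + 1) y = U.promote.rowCount (r + y) r := by
      rcases y with _ | y
      · rw [rowCount_eq_zero _ (by omega), rowmotionOrbit, if_pos (by omega)]
      · rw [T.rowmotionOrbit_of_le _ hx (by omega), ← hU', show t + 1 + x = t + x + 1 by ring]
        congr 1 <;> omega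
    have e5 : T.rowmotionOrbit (t + 1) x (y + 1) = U.rowCount (r + y + 2) (r + 1) := by
      rcases x with _ | x
      · rw [rowCount_of_le _ (by omega), rowmotionOrbit, if_pos (by omega)]
      · rw [T.rowmotionOrbit_of_le _ (by omega) hy, hU, show t + 1 + x = t + (x + 1) by ring]
        congr 1 <;> omega
    have e6 : min (T.rowmotionOrbit t (x + 2) (y + 1)) (U.rowCount (r + y + 2) r) =
        SkewFilling.capAbove (U.promote.rowCount (r + y)) (U.rowCount (r + y + 2) r) r := by
      rcases r with _ | r
      · rw [rowmotionOrbit, if_neg (by omega), if_pos (by omega), SkewFilling.capAbove,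
          min_eq_right (U.rowCount_le _ _)]
      · rw [SkewFilling.capAbove, T.rowmotionOrbit_of_le _ (by omega) hy, ← hU',
          show t + (x + 1) = t + x + 1 by ring]
        congr 2 <;> omega
    rw [e1, e2, e3, e4, e5, e6, h1, max_comm]

theorem rowCount_reciprocity {j r : ℕ} (hj : j ≤ k) (hr : r < m) :
    T.rowCount j r + ((promotion k m n ^ j) T).rowCount (k - j) (m - 1 - r) = n := by
  rcases Nat.lt_or_ge r j with h1 | h1
  · rcases Nat.lt_or_ge (j + (m - 1 - r)) k with h2 | h2
    · obtain ⟨y, rfl⟩ : ∃ y, j = r + 1 + y := ⟨j - r - 1, by omega⟩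
      obtain ⟨x, rfl⟩ : ∃ x, m = r + x + 1 := ⟨m - r - 1, by omega⟩
      -- Starting the orbit `x` promotions before `T` cancels the delay of row `r`, so that `T`
      -- itself is seen at time `0`. The delay `r` of the opposite row then makes up the total of `j
      -- = r + 1 + y` promotions.
      obtain ⟨T₀, rfl⟩ := (promotion k (r + x + 1) n ^ x).surjective T
      have h3 := T₀.isPLOrbit_rowmotionOrbit.reciprocity 0 (x := x) (y := y) (by omega) (by omega)
      rw [T₀.rowmotionOrbit_of_le 0 (by omega) (by omega),
        show r + x + 1 - x = r + 1 by omega,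
        show k - (r + x + 1) - y = (k - (r + x + 1) - y - 1) + 1 by omega,
        T₀.rowmotionOrbit_of_le _ (by omega) (by omega)] at h3
      rw [← Equiv.Perm.mul_apply, ← pow_add]
      convert h3 using 2
      · congr 1
        simp
      · rw [show r + 1 + y + x = 0 + x + y + 1 + r by ring]
        congr 1 <;> omega
    · rw [T.rowCount_eq_full (d := m - 1 - r) (by omega) h2, rowCount_eq_zero _ (by omega),
        add_zero]
  · rw [T.rowCount_eq_zero h1, rowCount_eq_full _ (d := r) (by omega) (by omega), zero_add]

/-- The entry of a tableau in a box is at most `j` if and only if the entry of its `j`-th promotion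
in the opposite box exceeds `k - j`. -/
theorem entry_le_iff {j r c : ℕ} (hj : j ≤ k) (hr : r < m) (hc : c < n) :
    T.1 r c ≤ j ↔ ¬ ((promotion k m n ^ j) T).1 (m - 1 - r) (n - 1 - c) ≤ k - j := by
  have h1 := T.rowCount_reciprocity hj hr
  have h2 := T.lt_rowCount (v := j) (r := r) (c := c)
  have h3 := ((promotion k m n ^ j) T).lt_rowCount (v := k - j) (r := m - 1 - r) (c := n - 1 - c)
  have h4 : T.1 r c ≤ j ↔ c < T.rowCount j r := by tauto
  have h5 : m - 1 - r < m ∧ n - 1 - c < n := by omega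
  rw [h4, show ((promotion k m n ^ j) T).1 (m - 1 - r) (n - 1 - c) ≤ k - j ↔
    n - 1 - c < ((promotion k m n ^ j) T).rowCount (k - j) (m - 1 - r) by tauto]
  omega

/-- On a finite set of tableaux that is invariant under promotion, the entries in two opposite boxes
have average `k + 1` when added. -/
theorem sum_entry_add_sum_entry {O : Finset (SSYT k (rectangle m n))}
    (hO : ∀ (j : ℕ) (T : SSYT k (rectangle m n)), T ∈ O ↔ (promotion k m n ^ j) T ∈ O)
    {r c : ℕ} (hr : r < m) (hc : c < n) :
    ∑ T ∈ O, T.1 r c + ∑ T ∈ O, T.1 (m - 1 - r) (n - 1 - c) = O.card * (k + 1) := by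
  -- An entry is the number of `j < k` below it, and each condition `j < T.1 r c` is rewritten by
  -- reciprocity.
  have e1 : ∀ T ∈ O, T.1 r c = ∑ j ∈ Finset.range k,
      if ((promotion k m n ^ j) T).1 (m - 1 - r) (n - 1 - c) ≤ k - j then 1 else 0 := by
    intro T _
    have hk := (T.2 r c (mem_rectangle.2 ⟨hr, hc⟩)).2
    have : ∀ j ∈ Finset.range k,
        (if ((promotion k m n ^ j) T).1 (m - 1 - r) (n - 1 - c) ≤ k - j then 1 else 0) =
          if j < T.1 r c then 1 else 0 := by
      intro j hj
      have := T.entry_le_iff (Finset.mem_range.1 hj).le hr hc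
      congr 1
      rw [eq_iff_iff, ← not_le, this, not_not]
    rw [Finset.sum_congr rfl this, ← Finset.card_filter]
    have : (Finset.range k).filter (fun j => j < T.1 r c) = Finset.range (T.1 r c) := by
      ext j
      simp only [Finset.mem_filter, Finset.mem_range]
      omega
    rw [this, Finset.card_range]
  have e2 : ∀ T ∈ O, (∑ j ∈ Finset.range k,
      if T.1 (m - 1 - r) (n - 1 - c) ≤ k - j then 1 else 0) + T.1 (m - 1 - r) (n - 1 - c) =
        k + 1 := by
    intro T _
    have hk := T.2 (m - 1 - r) (n - 1 - c) (mem_rectangle.2 ⟨by omega, by omega⟩)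
    rw [← Finset.card_filter]
    have : (Finset.range k).filter (fun j => T.1 (m - 1 - r) (n - 1 - c) ≤ k - j) =
        Finset.range (k + 1 - T.1 (m - 1 - r) (n - 1 - c)) := by
      ext j
      simp only [Finset.mem_filter, Finset.mem_range]
      omega
    rw [this, Finset.card_range]
    omega
  rw [Finset.sum_congr rfl e1, Finset.sum_comm]
  -- For each fixed `j`, invariance of `O` under the `j`-th power of promotion removes that power.
  have e3 : ∀ j ∈ Finset.range k, (∑ T ∈ O,
      if ((promotion k m n ^ j) T).1 (m - 1 - r) (n - 1 - c) ≤ k - j then 1 else 0) =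
        ∑ T ∈ O, if T.1 (m - 1 - r) (n - 1 - c) ≤ k - j then 1 else 0 := fun j _ =>
    Finset.sum_equiv (promotion k m n ^ j) (hO j) fun _ _ => rfl
  rw [Finset.sum_congr rfl e3, Finset.sum_comm, ← Finset.sum_add_distrib, Finset.sum_congr rfl e2,
    Finset.sum_const, smul_eq_mul]

theorem sum_entrySum (S : Finset (Fin m × Fin n)) (hS : S.image rotateBox = S)
    {O : Finset (SSYT k (rectangle m n))}
    (hO : ∀ (j : ℕ) (T : SSYT k (rectangle m n)), T ∈ O ↔ (promotion k m n ^ j) T ∈ O) :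
    ∑ T ∈ O, entrySum S T = O.card * (((k : ℂ) + 1) * S.card / 2) := by
  have hinj : Function.Injective (rotateBox : Fin m × Fin n → Fin m × Fin n) := by
    intro a b h
    simpa [rotateBox, Prod.ext_iff] using h
  have hrot : ∀ T : SSYT k (rectangle m n), entrySum S T =
      ∑ b ∈ S, (T.1 (m - 1 - b.1) (n - 1 - b.2) : ℂ) := by
    intro T
    conv_lhs => rw [entrySum, ← hS]
    rw [Finset.sum_image hinj.injOn]
    refine Finset.sum_congr rfl fun b _ => ?_
    simp only [rotateBox, Fin.val_rev]
    rw [show m - (b.1 + 1 : ℕ) = m - 1 - b.1 by omega, show n - (b.2 + 1 : ℕ) = n - 1 - b.2 by omega]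
  -- Twice the sum is written with one copy rotated, so that every box is paired with its opposite;
  -- a central box pairs with itself.
  have h2 : (∑ T ∈ O, entrySum S T) + ∑ T ∈ O, entrySum S T =
      S.card * (O.card * ((k : ℂ) + 1)) := by
    nth_rewrite 2 [Finset.sum_congr rfl fun T _ => hrot T]
    simp only [entrySum]
    rw [Finset.sum_comm, Finset.sum_comm (s := O), ← Finset.sum_add_distrib]
    rw [Finset.sum_congr rfl (g := fun _ => (O.card : ℂ) * ((k : ℂ) + 1)), Finset.sum_const,
      nsmul_eq_mul]
    intro b _
    exact_mod_cast sum_entry_add_sum_entry hO b.1.2 b.2.2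
  linear_combination h2 / 2

theorem orbitAverage_entrySum (S : Finset (Fin m × Fin n)) (hS : S.image rotateBox = S) :
    orbitAverage (Subgroup.zpowers (promotion k m n)) (entrySum (k := k) S) T =
      ((k : ℂ) + 1) * (S.card : ℂ) / 2 := by
  have hfin := (MulAction.orbit (Subgroup.zpowers (promotion k m n)) T).toFinite
  have hO : ∀ (j : ℕ) (U : SSYT k (rectangle m n)),
      U ∈ hfin.toFinset ↔ (promotion k m n ^ j) U ∈ hfin.toFinset := by
    intro j U
    rw [hfin.mem_toFinset, hfin.mem_toFinset]
    have h := MulAction.orbit_smul (⟨promotion k m n ^ j, Subgroup.npow_mem_zpowers _ j⟩ :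
      Subgroup.zpowers (promotion k m n)) U
    rw [← MulAction.orbit_eq_iff, ← h, MulAction.orbit_eq_iff]
    rfl
  have hcard : hfin.toFinset.card ≠ 0 := by
    rw [Finset.card_ne_zero]
    exact ⟨T, hfin.mem_toFinset.2 (MulAction.mem_orbit_self T)⟩
  rw [orbitAverage, finsum_mem_eq_finite_toFinset_sum _ hfin, Set.ncard_eq_toFinset_card _ hfin,
    sum_entrySum S hS hO, mul_div_cancel_left₀ _ (by exact_mod_cast hcard)]

end SSYT

theorem theorem1 (k m n : ℕ) (S : Finset (Fin m × Fin n)) (hS : S.image rotateBox = S) :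
    ∃ P : Equiv.Perm (SSYT k (rectangle m n)),
      IsPromotion P ∧
      IsHomomesic (Subgroup.zpowers P) (entrySum (k := k) S) ∧
      ∀ T : SSYT k (rectangle m n),
        orbitAverage (Subgroup.zpowers P) (entrySum (k := k) S) T
          = ((k : ℂ) + 1) * (S.card : ℂ) / 2 := by
  refine ⟨SSYT.promotion k m n, SSYT.isPromotion_promotion, ⟨fun T => Set.toFinite _, ?_⟩,
    fun T => T.orbitAverage_entrySum S hS⟩
  intro T T'
  rw [T.orbitAverage_entrySum S hS, T'.orbitAverage_entrySum S hS]
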